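/- Let $K$ be a field of characteristic zero, let $R$ be a solvable Lie algebra over $K$ of finite dimension $d$, let $\pi:\mathfrak{sl}(2,K)\to \mathrm{Der}(R)$ be a Lie algebra homomorphism which is an irreducible representation on $R$ (so $R\neq 0$), and let $L=\mathfrak{sl}(2,K)\oplus_\pi R$ be the corresponding semi-direct sum, so that $\dim L=n=d+3$. Let $b_1,\dots,b_n$ be any basis of $L$, with structure constants $[b_i,b_j]=\sum_k c_{ij}^k b_k$, and let $x_1,\dots,x_n$ be the corresponding coordinates on $L^*$ ($x_i(f)=f(b_i)$). The determining equations are $$\tilde v_i F:=-\sum_{j,k}c_{ij}^k\,x_k\,\frac{\partial F}{\partial x_j}=0\qquad(i=1,\dots,n).$$ Functions (or polynomials) are called functionally independent if their Jacobian matrix has full rank generically, i.e. for polynomials over the field of rational functions, and for analytic functions on a connected open set at some point of that set. A fundamental set of invariants is an (inclusion-)maximal functionally independent set of invariants. The number of invariants is $\mathcal N$ if fundamental sets exist and every one of them has exactly $\mathcal N$ elements. Then the number $\mathcal N$ of invariants of $L$ is \begin{itemize} \item[(a)] $\mathcal N=2$ if $d=1$; \item[(b)] $\mathcal N=1$ if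 $d=2$, and $\mathcal N=2$ if $d=3$; \item[(c)] $\mathcal N=d-3$ if $d\ge 4$. \end{itemize} This holds for each of the following notions of invariant: \begin{itemize} \item[(i)] for arbitrary $K$ of characteristic zero: polynomials $F\in K[x_1,\dots,x_n]$ satisfying the determining equations; \item[(ii)] for $K=\mathbb R$ or $\mathbb C$: analytic functions $F$ on $L^*$ with $F(g\cdot f)=F(f)$ for all $f\in L^*$ and all $g\in G$, where $G$ is a connected Lie group with Lie algebra $L$ acting by the coadjoint action $g\cdot f=f\circ\mathrm{Ad}_{g^{-1}}$ (so that $\mathrm{Ad}(G)$ is the group generated by the $\exp(\mathrm{ad}\,x)$, $x\in L$); \item[(iii)] for $K=\mathbb R$ or $\mathbb C$ and any non-empty connected open set $U\subseteq L^*$: analytic functions $F$ on $U$ satisfying the determining equations on $U$. \end{itemize} -/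

import Mathlib

namespace CoadjointInvariants

/-- A representation `π` of `S` by derivations of `R` is irreducible: `R ≠ 0` and the only
`π(S)`-stable subspaces of `R` are `0` and `R`. -/
def IsIrreducibleRep {K S R : Type*} [Field K] [LieRing S] [LieAlgebra K S]
    [LieRing R] [LieAlgebra K R] (π : S →ₗ⁅K⁆ LieDerivation K R R) : Prop :=
  Nontrivial R ∧
    ∀ W : Submodule K R, (∀ s : S, ∀ v ∈ W, π s v ∈ W) → W = ⊥ ∨ W = ⊤

/-- A fundamental set: a maximal independent set of invariants. -/
def IsFundamentalSet {α : Type*} (invariants : Set α) (indep : Set α → Prop) (S : Set α) : Prop :=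
  Maximal (fun T : Set α => T ⊆ invariants ∧ indep T) S

/-- The number of invariants is `N`: fundamental sets exist and each of them has exactly `N`
elements. -/
def NumberIs {α : Type*} (invariants : Set α) (indep : Set α → Prop) (N : ℕ) : Prop :=
  (∃ S, IsFundamentalSet invariants indep S) ∧
    ∀ S, IsFundamentalSet invariants indep S → S.encard = N

/-- The structure constants `c_{ij}^k`, given by `[b_i, b_j] = ∑ k, c_{ij}^k b_k`. -/
noncomputable def structConst {ι K L : Type*} [Field K] [LieRing L] [LieAlgebra K L]
    (b : Module.Basis ι K L) (i j k : ι) : K :=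
  b.repr ⁅b i, b j⁆ k

section Polynomial

variable {ι K L : Type*} [Fintype ι] [Field K] [LieRing L] [LieAlgebra K L]

/-- The infinitesimal generator `- ∑ j k, c_{ij}^k x_k ∂/∂x_j` of the coadjoint representation
attached to `b i`, acting on polynomial functions on the dual space of `L`. -/
noncomputable def polyGenerator (b : Module.Basis ι K L) (i : ι) (F : MvPolynomial ι K) :
    MvPolynomial ι K :=
  - ∑ j, ∑ k, MvPolynomial.C (structConst b i j k) * MvPolynomial.X k * MvPolynomial.pderiv j F

/-- The polynomial invariants of the coadjoint representation: the polynomial solutions of the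
determining equations. -/
def polyInvariants (b : Module.Basis ι K L) : Set (MvPolynomial ι K) :=
  {F | ∀ i, polyGenerator b i F = 0}

/-- Functional independence of polynomials: their differentials (the rows of the Jacobian matrix)
are linearly independent over the ring of polynomials, equivalently over the field of
rational functions. -/
def PolyIndependent (S : Set (MvPolynomial ι K)) : Prop :=
  LinearIndependent (MvPolynomial ι K)
    (fun F : S => (fun j : ι => MvPolynomial.pderiv j (F : MvPolynomial ι K)))

/-- `L` has exactly `N` functionally independent polynomial invariants. -/
def PolyNumberIs (b : Module.Basis ι K L) (N : ℕ) : Prop :=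
  NumberIs (polyInvariants b) PolyIndependent N

end Polynomial

section Analytic

/- A point `p : ι → 𝕜` stands for the functional `f` on `L` with `f (b i) = p i`, that is, `p` lists
the coordinates of `f` in the basis dual to `b`. -/

variable {ι 𝕜 L : Type*} [Fintype ι] [RCLike 𝕜] [LieRing L] [LieAlgebra 𝕜 L]

/-- The group `Ad(G)` of a connected Lie group `G` with Lie algebra `L`, as matrices in the
basis `b`: it is generated by the `exp (ad x)`, for `x` in `L`. -/
noncomputable def adjointGroup [DecidableEq ι] (b : Module.Basis ι 𝕜 L) :
    Subgroup (Matrix.GeneralLinearGroup ι 𝕜) :=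
  Subgroup.closure {g | ∃ x : L,
    (g : Matrix ι ι 𝕜) = NormedSpace.exp (LinearMap.toMatrix b b (LieAlgebra.ad 𝕜 L x))}

/-- The coadjoint action `g • f = f ∘ Ad(g⁻¹)` in coordinates: functionals are row vectors. -/
noncomputable def coadjoint [DecidableEq ι] (g : Matrix.GeneralLinearGroup ι 𝕜) (p : ι → 𝕜) :
    ι → 𝕜 :=
  Matrix.vecMul p ((g⁻¹ : Matrix.GeneralLinearGroup ι 𝕜) : Matrix ι ι 𝕜)

/-- The invariants of the coadjoint representation: the analytic functions on the whole dual space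
that are constant on the orbits of the coadjoint action. -/
def analyticInvariants [DecidableEq ι] (b : Module.Basis ι 𝕜 L) : Set ((ι → 𝕜) → 𝕜) :=
  {F | AnalyticOnNhd 𝕜 F Set.univ ∧ ∀ g ∈ adjointGroup b, ∀ p, F (coadjoint g p) = F p}

/-- The value at `p` of the infinitesimal generator `- ∑ j k, c_{ij}^k x_k ∂/∂x_j` applied
to `F`. -/
noncomputable def generatorAt [DecidableEq ι] (b : Module.Basis ι 𝕜 L) (i : ι)
    (F : (ι → 𝕜) → 𝕜) (p : ι → 𝕜) : 𝕜 :=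
  - ∑ j, ∑ k, structConst b i j k * p k * fderiv 𝕜 F p (Pi.single j 1)

/-- The formal (local) invariants on `U`: the analytic solutions on `U` of the determining
equations. -/
def localInvariants [DecidableEq ι] (b : Module.Basis ι 𝕜 L) (U : Set (ι → 𝕜)) :
    Set ((ι → 𝕜) → 𝕜) :=
  {F | AnalyticOnNhd 𝕜 F U ∧ ∀ i, ∀ p ∈ U, generatorAt b i F p = 0}

/-- Functional independence on a connected open set `U` of functions analytic on `U`: the Jacobian
matrix has full rank somewhere on `U` (hence on a dense open subset of `U`). -/
def IndependentOn (U : Set (ι → 𝕜)) (S : Set ((ι → 𝕜) → 𝕜)) : Prop :=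
  ∃ p ∈ U, LinearIndependent 𝕜 (fun F : S => fderiv 𝕜 (F : (ι → 𝕜) → 𝕜) p)

/-- `L` has exactly `N` functionally independent analytic invariants on its dual space. -/
def AnalyticNumberIs [DecidableEq ι] (b : Module.Basis ι 𝕜 L) (N : ℕ) : Prop :=
  NumberIs (analyticInvariants b) (IndependentOn Set.univ) N

/-- On every nonempty connected open subset of the dual space, `L` has exactly `N` functionally
independent formal invariants. -/
def LocalNumberIs [DecidableEq ι] (b : Module.Basis ι 𝕜 L) (N : ℕ) : Prop :=
  ∀ U : Set (ι → 𝕜), IsOpen U → IsConnected U →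
    NumberIs (localInvariants b U) (IndependentOn U) N

end Analytic

end CoadjointInvariants

/-! ### Exchange, and linear independence over polynomial rings -/

namespace CoadjointInvariants

open MvPolynomial

/-! The determining equations at a point `p` say that the gradient of an invariant lies in the
kernel of the commutator matrix `∑ k, c_{ij}^k p_k`. Hence its corank at a single point bounds the
number of independent invariants, while polynomial invariants with independent gradients at a single
point give a lower bound. Both one-point facts spread to the non-vanishing set of a polynomial, and
polynomial invariants belong to all three classes, so `numberIs_of_grad` yields the count for all of
them once the two bounds agree.

The ideal `[R, R]` is `π`-stable and, by solvability, proper; so it is zero and `R` is abelian. Thus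
`L` is the semi-direct sum of `sl₂` and its irreducible module of highest weight `m = d - 1`
(`exists_standardFrame`). The coranks come from evaluating at one dual basis vector, and for `m ≤ 2`
the invariants are written down explicitly.

For `m ≥ 3` the invariants of binary forms of degree `m` suffice. Write the form as `A * ∏ (X - α
j)`. Products of root differences in which every root occurs `2 * (m - 1)` times, multiplied by `A ^
(2 * (m - 1))`, are killed by `sl₂`; their power sums are symmetric in the roots and descend to
polynomials in the coefficients (`exists_coeffInvariant`). A tangent vector killed by all these
invariants preserves all cross-ratios infinitesimally, so it vanishes as soon as it fixes three
roots (`eq_zero_of_dotProduct_gradAt_rootForms`). The gradients therefore span at least `(m + 1) - 3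
= d - 3` dimensions. -/

lemma numberIs_of_exchange {α : Type*} {invariants : Set α} {indep : Set α → Prop} {N : ℕ}
    (h0 : indep ∅)
    (hub : ∀ T ⊆ invariants, indep T → T.encard ≤ N)
    (hext : ∀ T ⊆ invariants, indep T → T.encard < N →
      ∃ G ∈ invariants, G ∉ T ∧ indep (insert G T)) :
    NumberIs invariants indep N := by
  have hmax : ∀ S, IsFundamentalSet invariants indep S → S.encard = N := by
    intro S hS
    refine le_antisymm (hub S hS.prop.1 hS.prop.2) (not_lt.1 fun hlt => ?_)
    obtain ⟨G, hG, hGS, hi⟩ := hext S hS.prop.1 hS.prop.2 hlt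
    exact hGS (hS.2 ⟨Set.insert_subset hG hS.prop.1, hi⟩ (Set.subset_insert _ _)
      (Set.mem_insert _ _))
  refine ⟨?_, hmax⟩
  -- Existence: the empty set is enlarged one element at a time. At size `N` the upper bound makes
  -- the set maximal.
  have hex : ∀ k ≤ N, ∃ T ⊆ invariants, indep T ∧ T.encard = k := by
    intro k
    induction k with
    | zero => exact fun _ => ⟨∅, Set.empty_subset _, h0, by simp⟩
    | succ k ih =>
      intro hk
      obtain ⟨T, hT, hi, hc⟩ := ih (by omega)
      obtain ⟨G, hG, hGT, hi'⟩ := hext T hT hi (by rw [hc]; exact_mod_cast hk)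
      exact ⟨insert G T, Set.insert_subset hG hT, hi', by
        rw [Set.encard_insert_of_notMem hGT, hc]; norm_cast⟩
  obtain ⟨T, hT, hi, hc⟩ := hex N le_rfl
  refine ⟨T, ⟨hT, hi⟩, fun T' hT' hTT' => ?_⟩
  have hfin : T'.Finite := Set.finite_of_encard_le_coe (hub T' hT'.1 hT'.2)
  exact (hfin.eq_of_subset_of_encard_le' hTT' (by rw [hc]; exact hub T' hT'.1 hT'.2)).ge

lemma exists_right_inverse_of_linearIndependent {F ι τ : Type*} [Field F] [Fintype ι] [Fintype τ]
    [DecidableEq τ] {V : τ → ι → F} (h : LinearIndependent F V) :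
    ∃ W : Matrix ι τ F, Matrix.of V * W = 1 := by
  classical
  obtain ⟨g, hg⟩ := LinearMap.exists_leftInverse_of_injective (Fintype.linearCombination F V)
    (LinearMap.ker_eq_bot.2 (LinearIndependent.fintypeLinearCombination_injective h))
  refine ⟨(LinearMap.toMatrix' g).transpose, ?_⟩
  have h1 : LinearMap.toMatrix' (Fintype.linearCombination F V) = (Matrix.of V).transpose := by
    ext i t
    simp [LinearMap.toMatrix'_apply, Fintype.linearCombination_apply_single]
  have h2 := congr_arg LinearMap.toMatrix' hg
  rw [LinearMap.toMatrix'_comp, LinearMap.toMatrix'_id, h1] at h2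
  simpa using congr_arg Matrix.transpose h2

lemma linearIndependent_iff_vecMul {F ι τ : Type*} [CommRing F] [Fintype τ] {V : τ → ι → F} :
    LinearIndependent F V ↔ ∀ c, Matrix.vecMul c (Matrix.of V) = 0 → c = 0 := by
  rw [Fintype.linearIndependent_iff]
  have h : ∀ c : τ → F, ∑ t, c t • V t = Matrix.vecMul c (Matrix.of V) := fun c => by
    ext j; simp [Matrix.vecMul, dotProduct]
  simp only [h, funext_iff, Pi.zero_apply]

/-- A family of vectors whose entries are polynomials and that is linearly independent at one point
is linearly independent wherever a suitable non-zero polynomial does not vanish, and it is linearly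
independent over the ring of polynomials. -/
lemma exists_polynomial_of_linearIndependent {K ι κ τ : Type*} [Field K] [Fintype ι] [Finite τ]
    (V : τ → ι → MvPolynomial κ K) (p : κ → K)
    (h : LinearIndependent K fun t j => eval p (V t j)) :
    LinearIndependent (MvPolynomial κ K) V ∧ ∃ P : MvPolynomial κ K, P ≠ 0 ∧
      ∀ q, eval q P ≠ 0 → LinearIndependent K fun t j => eval q (V t j) := by
  classical
  cases nonempty_fintype τ
  obtain ⟨W, hW⟩ := exists_right_inverse_of_linearIndependent h
  let W' : Matrix ι τ (MvPolynomial κ K) := W.map C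
  -- `W` is a constant right inverse at `p`, so `M.det` takes the value `1` at `p`; wherever it is
  -- non-zero, a relation `c V = 0` gives `c M = 0` and so `c = 0`.
  let M : Matrix τ τ (MvPolynomial κ K) := Matrix.of V * W'
  have hM : ∀ q, M.map (eval q) = Matrix.of (fun t j => eval q (V t j)) * W := fun q => by
    rw [Matrix.map_mul]
    congr 1
    ext; simp [W']
  have hdet : ∀ q, eval q M.det = (M.map (eval q)).det := fun q => RingHom.map_det _ _
  have hMne : M.det ≠ 0 := by
    intro h0
    have := hdet p
    rw [h0, hM, hW] at this
    simp at this
  refine ⟨linearIndependent_iff_vecMul.2 fun c hc => ?_, M.det, hMne, fun q hq =>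
    linearIndependent_iff_vecMul.2 fun c hc => ?_⟩
  · refine Matrix.eq_zero_of_vecMul_eq_zero hMne ?_
    rw [← Matrix.vecMul_vecMul, hc, Matrix.zero_vecMul]
  · rw [hdet] at hq
    refine Matrix.eq_zero_of_vecMul_eq_zero hq ?_
    rw [hM, ← Matrix.vecMul_vecMul, hc, Matrix.zero_vecMul]

lemma exists_eval_ne_zero {K κ : Type*} [Field K] [Infinite K] {P : MvPolynomial κ K}
    (hP : P ≠ 0) : ∃ q, eval q P ≠ 0 := by
  by_contra! h
  exact hP (MvPolynomial.funext fun q => by rw [h q, map_zero])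

/-- A family of vectors of polynomials that is linearly independent over the ring of polynomials
is linearly independent at some point where a given non-zero polynomial does not vanish. -/
lemma exists_point_of_linearIndependent {K ι κ τ : Type*} [Field K] [Infinite K] [Fintype ι]
    [Finite τ] (V : τ → ι → MvPolynomial κ K) (h : LinearIndependent (MvPolynomial κ K) V)
    {P : MvPolynomial κ K} (hP : P ≠ 0) :
    ∃ q, eval q P ≠ 0 ∧ LinearIndependent K fun t j => eval q (V t j) := by
  classical
  cases nonempty_fintype τ
  let A := MvPolynomial κ K
  let F := FractionRing A
  have ha : Function.Injective (algebraMap A F) := IsFractionRing.injective _ F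
  have hF : LinearIndependent F fun t j => algebraMap A F (V t j) := by
    rw [← LinearIndependent.iff_fractionRing A F]
    exact h.map' (LinearMap.compLeft (Algebra.linearMap A F) ι)
      (LinearMap.ker_eq_bot.2 fun x y hxy => funext fun j => ha (congr_fun hxy j))
  obtain ⟨W, hW⟩ := exists_right_inverse_of_linearIndependent hF
  -- `D` clears the denominators of a right inverse over the fraction field, so `V * W' = D • 1`
  -- over the polynomial ring. This can be evaluated at any point, and independence follows wherever
  -- `D` is non-zero.
  obtain ⟨D, hD⟩ := IsLocalization.exist_integer_multiples_of_finite (nonZeroDivisors A)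
    (fun jt : ι × τ => W jt.1 jt.2)
  choose w hw using hD
  let W' : Matrix ι τ A := fun j t => w (j, t)
  have hM : Matrix.of V * W' = (D : A) • (1 : Matrix τ τ A) := by
    refine Matrix.map_injective ha ?_
    have hW' : W'.map (algebraMap A F) = algebraMap A F D • W := by
      ext j t
      simpa [Algebra.smul_def] using hw (j, t)
    beta_reduce
    rw [Matrix.map_mul, hW', Matrix.mul_smul]
    change algebraMap A F D • (Matrix.of (fun t j => algebraMap A F (V t j)) * W) = _
    rw [hW]
    ext i j
    by_cases hij : i = j <;> simp [hij]
  have hDne : (D : A) ≠ 0 := nonZeroDivisors.ne_zero D.2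
  obtain ⟨q, hq⟩ := exists_eval_ne_zero (mul_ne_zero hP hDne)
  rw [map_mul] at hq
  refine ⟨q, left_ne_zero_of_mul hq, linearIndependent_iff_vecMul.2 fun c hc => ?_⟩
  have h2 : Matrix.vecMul c ((Matrix.of V * W').map (eval q)) = 0 := by
    rw [Matrix.map_mul, ← Matrix.vecMul_vecMul]
    change Matrix.vecMul (Matrix.vecMul c (Matrix.of fun t j => eval q (V t j))) _ = 0
    rw [hc, Matrix.zero_vecMul]
  have h3 : (Matrix.of V * W').map (eval q) = eval q (D : A) • (1 : Matrix τ τ K) := by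
    rw [hM]
    ext i j
    by_cases hij : i = j <;> simp [hij]
  rw [h3, Matrix.vecMul_smul, Matrix.vecMul_one] at h2
  exact (smul_eq_zero.1 h2).resolve_left (right_ne_zero_of_mul hq)

end CoadjointInvariants

/-! ### Counting invariants by the corank of the commutator matrix -/

namespace CoadjointInvariants

open MvPolynomial Module

section Generic

variable {ι K L : Type*} [Fintype ι] [Field K] [LieRing L] [LieAlgebra K L]

/-- The differential of the polynomial `F` at the point `p`. -/
noncomputable def gradAt (p : ι → K) (F : MvPolynomial ι K) : ι → K :=
  fun j => eval p (pderiv j F)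

/-- The matrix of the generators at `p`, which is the commutator matrix of `L`. -/
noncomputable def commMatrix (b : Basis ι K L) (p : ι → K) : Matrix ι ι K :=
  fun i j => ∑ k, structConst b i j k * p k

lemma exists_linearIndependent_comp_of_le_finrank {V β : Type*} [AddCommGroup V] [Module K V]
    [FiniteDimensional K V] (v : β → V) {N : ℕ} (h : N ≤ finrank K (Submodule.span K (Set.range v))) :
    ∃ g : Fin N → β, LinearIndependent K (v ∘ g) := by
  obtain ⟨κ, a, -, hspan, hli⟩ := exists_linearIndependent' K v
  have : Finite κ := hli.finite
  cases nonempty_fintype κ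
  rw [← hspan, finrank_span_eq_card hli] at h
  obtain ⟨e⟩ : Nonempty (Fin N ↪ κ) :=
    Function.Embedding.nonempty_of_card_le (by simpa using h)
  exact ⟨a ∘ e, by simpa [Function.comp_assoc] using hli.comp e e.injective⟩

/-- The corank of the commutator matrix is upper semicontinuous. -/
lemma exists_polynomial_of_corank_le (b : Basis ι K L) {N : ℕ} {p : ι → K}
    (h : finrank K (LinearMap.ker (commMatrix b p).mulVecLin) ≤ N) :
    ∃ P : MvPolynomial ι K, P ≠ 0 ∧ ∀ q, eval q P ≠ 0 →
      finrank K (LinearMap.ker (commMatrix b q).mulVecLin) ≤ N := by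
  have hrn : ∀ q, (commMatrix b q).rank + finrank K (LinearMap.ker (commMatrix b q).mulVecLin) =
      Fintype.card ι := fun q => by
    rw [Matrix.rank, LinearMap.finrank_range_add_finrank_ker, finrank_fintype_fun_eq_card]
  -- A maximal independent set of rows at `p`; the entries are linear polynomials in the point, so
  -- these rows stay independent generically.
  obtain ⟨g, hg⟩ := exists_linearIndependent_comp_of_le_finrank (commMatrix b p).row
    (Matrix.rank_eq_finrank_span_row _).le
  let V : Fin (commMatrix b p).rank → ι → MvPolynomial ι K :=
    fun t j => ∑ k, C (structConst b (g t) j k) * X k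
  have hV : ∀ q, (fun t j => eval q (V t j)) = (commMatrix b q).row ∘ g := fun q => by
    ext t j
    simp only [V, map_sum, map_mul, eval_C, eval_X]
    rfl
  obtain ⟨-, P, hP, hq⟩ := exists_polynomial_of_linearIndependent V p (by rw [hV]; exact hg)
  refine ⟨P, hP, fun q hPq => ?_⟩
  have h1 := hq q hPq
  rw [hV] at h1
  have h2 : (commMatrix b p).rank ≤ (commMatrix b q).rank := by
    rw [Matrix.rank_eq_finrank_span_row (commMatrix b q)]
    calc (commMatrix b p).rank = Fintype.card (Fin (commMatrix b p).rank) := by simp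
      _ = finrank K (Submodule.span K (Set.range ((commMatrix b q).row ∘ g))) :=
        (finrank_span_eq_card h1).symm
      _ ≤ _ := Submodule.finrank_mono (Submodule.span_mono (Set.range_comp_subset_range _ _))
  have := hrn p
  have := hrn q
  omega

/-- If the commutator matrix has corank at most `N` at some point and there are `N` polynomial
invariants with linearly independent differentials at some point, then the number of invariants
is `N`. -/
theorem numberIs_of_grad (b : Basis ι K L) {N : ℕ}
    (hU : ∃ p, finrank K (LinearMap.ker (commMatrix b p).mulVecLin) ≤ N)
    (hL : ∃ p, N ≤ finrank K (Submodule.span K (gradAt p '' polyInvariants b)))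
    {α : Type*} (invariants : Set α) (indep : Set α → Prop) (U : Set (ι → K)) (hne : U.Nonempty)
    (grad : (ι → K) → α → ι → K) (ofPoly : MvPolynomial ι K → α)
    (hgeneric : ∀ T ⊆ invariants, indep T → ∀ P : MvPolynomial ι K, P ≠ 0 →
      ∃ q ∈ U, eval q P ≠ 0 ∧ LinearIndepOn K (grad q) T)
    (hindep : ∀ T ⊆ invariants, ∀ q ∈ U, LinearIndepOn K (grad q) T → indep T)
    (hrad : ∀ F ∈ invariants, ∀ q ∈ U, (commMatrix b q).mulVec (grad q F) = 0)
    (hpoly : ∀ F ∈ polyInvariants b, ofPoly F ∈ invariants ∧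
      ∀ q ∈ U, grad q (ofPoly F) = gradAt q F) :
    NumberIs invariants indep N := by
  -- The notion of invariant enters only through `hgeneric`, `hindep`, `hrad` and `hpoly`:
  -- independence must be visible at a point of `U` avoiding any given hypersurface, and conversely
  -- be implied by independence at one point of `U`.
  obtain ⟨p, hp⟩ := hU
  obtain ⟨P, hP0, hP⟩ := exists_polynomial_of_corank_le b hp
  obtain ⟨p', hp'⟩ := hL
  rw [Set.image_eq_range] at hp'
  obtain ⟨G, hG⟩ := exists_linearIndependent_comp_of_le_finrank
    (fun F : polyInvariants b => gradAt p' (F : MvPolynomial ι K)) hp'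
  obtain ⟨-, P', hP0', hP'⟩ := exists_polynomial_of_linearIndependent
    (fun i j => pderiv j (G i : MvPolynomial ι K)) p' hG
  refine numberIs_of_exchange ?_ ?_ ?_
  · obtain ⟨q, hq⟩ := hne
    exact hindep ∅ (Set.empty_subset _) q hq (linearIndepOn_empty _ _)
  · intro T hT hi
    -- At such a point the gradients of `T` are independent vectors of a kernel of dimension at most
    -- `N`.
    obtain ⟨q, hqU, hqP, hli⟩ := hgeneric T hT hi P hP0
    have : Finite T := LinearIndependent.finite hli
    cases nonempty_fintype T
    let g : T → LinearMap.ker (commMatrix b q).mulVecLin := fun t =>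
      ⟨grad q t, LinearMap.mem_ker.2 (hrad t (hT t.2) q hqU)⟩
    have hg : LinearIndependent K g := LinearIndependent.of_comp (Submodule.subtype _) hli
    have h1 := hg.fintype_card_le_finrank.trans (hP q hqP)
    rw [Set.encard_eq_coe_toFinset_card, Set.toFinset_card]
    exact_mod_cast h1
  · intro T hT hi hlt
    obtain ⟨q, hqU, hqP, hli⟩ := hgeneric T hT hi P' hP0'
    have hfin : T.Finite := Set.finite_of_encard_le_coe hlt.le
    have : Finite T := hfin
    cases nonempty_fintype T
    have h1 := hP' q hqP
    -- The `N` independent gradients of the `G i` cannot all lie in the span of fewer than `N`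
    -- gradients, so some `G i` extends `T`.
    obtain ⟨i, hi'⟩ : ∃ i, gradAt q (G i : MvPolynomial ι K) ∉
        Submodule.span K (grad q '' T) := by
      by_contra! hall
      let g : Fin N → Submodule.span K (grad q '' T) := fun i => ⟨_, hall i⟩
      have hg : LinearIndependent K g := LinearIndependent.of_comp (Submodule.subtype _) h1
      have h2 := hg.fintype_card_le_finrank
      have h3 : finrank K (Submodule.span K (grad q '' T)) = Fintype.card T := by
        rw [Set.image_eq_range]
        exact finrank_span_eq_card hli
      rw [h3, Fintype.card_fin] at h2
      rw [Set.encard_eq_coe_toFinset_card, Set.toFinset_card] at hlt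
      exact absurd (by exact_mod_cast hlt) (not_lt.2 h2)
    have h4 := hpoly _ (G i).2
    rw [← h4.2 q hqU] at hi'
    have hGT : ofPoly (G i) ∉ T := fun hmem =>
      hi' (Submodule.subset_span (Set.mem_image_of_mem _ hmem))
    exact ⟨_, h4.1, hGT, hindep _ (Set.insert_subset h4.1 hT) q hqU
      ((linearIndepOn_insert hGT).2 ⟨hli, hi'⟩)⟩

lemma commMatrix_mulVec_gradAt (b : Basis ι K L) {F : MvPolynomial ι K}
    (hF : F ∈ polyInvariants b) (p : ι → K) : (commMatrix b p).mulVec (gradAt p F) = 0 := by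
  ext i
  have h := congr_arg (eval p) (hF i)
  rw [polyGenerator, map_neg, map_zero, neg_eq_zero] at h
  simpa [Matrix.mulVec, dotProduct, commMatrix, gradAt, Finset.sum_mul] using h

theorem polyNumberIs_of_grad [CharZero K] (b : Basis ι K L) {N : ℕ}
    (hU : ∃ p, finrank K (LinearMap.ker (commMatrix b p).mulVecLin) ≤ N)
    (hL : ∃ p, N ≤ finrank K (Submodule.span K (gradAt p '' polyInvariants b))) :
    PolyNumberIs b N := by
  refine numberIs_of_grad b hU hL _ _ Set.univ Set.univ_nonempty gradAt id ?_ ?_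
    (fun F hF q _ => commMatrix_mulVec_gradAt b hF q) (fun F hF => ⟨hF, fun _ _ => rfl⟩)
  · intro T _ hi P hP
    have : Finite T := LinearIndependent.finite hi
    obtain ⟨q, hq, hli⟩ := exists_point_of_linearIndependent _ hi hP
    exact ⟨q, trivial, hq, hli⟩
  · intro T _ q _ hli
    have : Finite T := LinearIndependent.finite hli
    exact (exists_polynomial_of_linearIndependent
      (fun (F : T) j => pderiv j (F : MvPolynomial ι K)) q hli).1

end Generic

end CoadjointInvariants

/-! ### Analytic invariants, local and global -/

namespace CoadjointInvariants

open MvPolynomial Module Filter Topology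

section AnalyticFunctions

variable {ι 𝕜 L : Type*} [Fintype ι] [RCLike 𝕜] [LieRing L] [LieAlgebra 𝕜 L]

lemma hasFDerivAt_eval (F : MvPolynomial ι 𝕜) (q : ι → 𝕜) :
    HasFDerivAt (fun p => eval p F)
      (∑ j, gradAt q F j • (ContinuousLinearMap.proj j : (ι → 𝕜) →L[𝕜] 𝕜)) q := by
  classical
  induction F using MvPolynomial.induction_on with
  | C a =>
    have h : HasFDerivAt (fun p : ι → 𝕜 => eval p (C a : MvPolynomial ι 𝕜))
        (0 : (ι → 𝕜) →L[𝕜] 𝕜) q := by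
      simp only [eval_C]; exact hasFDerivAt_const a q
    exact h.congr_fderiv (by ext v; simp [gradAt])
  | add F G hF hG =>
    simp only [map_add]
    exact (hF.add hG).congr_fderiv (by ext; simp [gradAt, add_mul, Finset.sum_add_distrib])
  | mul_X F i hF =>
    have hX : HasFDerivAt (fun p : ι → 𝕜 => p i)
      (ContinuousLinearMap.proj i : (ι → 𝕜) →L[𝕜] 𝕜) q :=
      (ContinuousLinearMap.proj i : (ι → 𝕜) →L[𝕜] 𝕜).hasFDerivAt
    simp only [map_mul, eval_X]
    refine (hF.mul hX).congr_fderiv ?_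
    ext v
    simp [gradAt, Derivation.leibniz, pderiv_X, Finset.sum_add_distrib, add_mul, Finset.mul_sum,
      Pi.single_apply, apply_ite (eval q), mul_assoc]

variable [DecidableEq ι]

/-- The vector of the partial derivatives of `F` at `q`. -/
noncomputable def fgradAt (q : ι → 𝕜) (F : (ι → 𝕜) → 𝕜) : ι → 𝕜 :=
  fun j => fderiv 𝕜 F q (Pi.single j 1)

lemma fgradAt_eval (q : ι → 𝕜) (F : MvPolynomial ι 𝕜) :
    fgradAt q (fun p => eval p F) = gradAt q F := by
  ext j
  simp [fgradAt, (hasFDerivAt_eval F q).fderiv, Pi.single_apply]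

lemma commMatrix_mulVec_fgradAt (b : Basis ι 𝕜 L) (q : ι → 𝕜) (F : (ι → 𝕜) → 𝕜) (i : ι) :
    (commMatrix b q).mulVec (fgradAt q F) i = -generatorAt b i F q := by
  simp [Matrix.mulVec, dotProduct, commMatrix, generatorAt, fgradAt, Finset.sum_mul]

lemma fderiv_apply_eq_sum (q v : ι → 𝕜) (F : (ι → 𝕜) → 𝕜) :
    fderiv 𝕜 F q v = ∑ j, v j * fgradAt q F j := by
  conv_lhs => rw [pi_eq_sum_univ' v, map_sum]
  simp only [map_smul, smul_eq_mul, fgradAt]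

/-- Restriction of a linear functional to the standard basis. -/
def dualToVec : ((ι → 𝕜) →L[𝕜] 𝕜) →ₗ[𝕜] (ι → 𝕜) where
  toFun φ j := φ (Pi.single j 1)
  map_add' _ _ := rfl
  map_smul' _ _ := rfl

lemma dualToVec_injective : Function.Injective (dualToVec (ι := ι) (𝕜 := 𝕜)) := by
  intro φ ψ h
  refine ContinuousLinearMap.coe_injective (LinearMap.pi_ext' fun j => LinearMap.ext_ring ?_)
  exact congr_fun h j

/-- Independence of a finite family is an open condition, and the derivatives depend continuously on
the point. -/
lemma eventually_linearIndepOn {T : Set ((ι → 𝕜) → 𝕜)} {p : ι → 𝕜}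
    (hT : ∀ F ∈ T, AnalyticAt 𝕜 F p)
    (h : LinearIndependent 𝕜 (fun F : T => fderiv 𝕜 (F : (ι → 𝕜) → 𝕜) p)) :
    ∀ᶠ q in 𝓝 p, LinearIndepOn 𝕜 (fgradAt q) T := by
  have : Finite T := h.finite
  have hc : Tendsto (fun q => fun F : T => fderiv 𝕜 (F : (ι → 𝕜) → 𝕜) q) (𝓝 p)
      (𝓝 (fun F : T => fderiv 𝕜 (F : (ι → 𝕜) → 𝕜) p)) :=
    tendsto_pi_nhds.2 fun F => (hT F F.2).fderiv.continuousAt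
  filter_upwards [hc.eventually h.eventually] with q hq
  exact hq.map' dualToVec (LinearMap.ker_eq_bot.2 dualToVec_injective)

-- By the identity theorem a polynomial vanishing near one point vanishes everywhere.
omit [DecidableEq ι] in
lemma frequently_eval_ne_zero {P : MvPolynomial ι 𝕜} (hP : P ≠ 0) (p : ι → 𝕜) :
    ∃ᶠ q in 𝓝 p, eval q P ≠ 0 := by
  intro h
  simp only [ne_eq, not_not] at h
  have h1 : (fun q => eval q P) = fun _ => (0 : 𝕜) :=
    AnalyticOnNhd.eq_of_eventuallyEq (AnalyticOnNhd.eval_mvPolynomial P) analyticOnNhd_const h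
  exact hP (MvPolynomial.funext fun q => by rw [congr_fun h1 q, map_zero])

lemma generatorAt_eval (b : Basis ι 𝕜 L) {F : MvPolynomial ι 𝕜} (hF : F ∈ polyInvariants b)
    (i : ι) (q : ι → 𝕜) : generatorAt b i (fun p => eval p F) q = 0 := by
  rw [← neg_eq_zero, ← commMatrix_mulVec_fgradAt, fgradAt_eval, commMatrix_mulVec_gradAt b hF,
    Pi.zero_apply]

/-- Any class lying between the polynomial invariants and the local invariants on `U` has the same
count, so this serves both analytic notions. -/
theorem numberIs_of_subset_localInvariants (b : Basis ι 𝕜 L) {N : ℕ}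
    (hU : ∃ p, finrank 𝕜 (LinearMap.ker (commMatrix b p).mulVecLin) ≤ N)
    (hL : ∃ p, N ≤ finrank 𝕜 (Submodule.span 𝕜 (gradAt p '' polyInvariants b)))
    {U : Set (ι → 𝕜)} (hUo : IsOpen U) (hne : U.Nonempty) {invariants : Set ((ι → 𝕜) → 𝕜)}
    (hsub : invariants ⊆ localInvariants b U)
    (hpoly : ∀ F ∈ polyInvariants b, (fun p => eval p F) ∈ invariants) :
    NumberIs invariants (IndependentOn U) N := by
  refine numberIs_of_grad b hU hL _ _ U hne fgradAt (fun F p => eval p F) ?_ ?_ ?_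
    (fun F hF => ⟨hpoly F hF, fun q _ => fgradAt_eval q F⟩)
  · rintro T hT ⟨p, hp, hli⟩ P hP
    have h1 := eventually_linearIndepOn (fun F hF => (hsub (hT hF)).1 p hp) hli
    obtain ⟨q, hqP, hq, hqU⟩ := ((frequently_eval_ne_zero hP p).and_eventually
      (h1.and (hUo.eventually_mem hp))).exists
    exact ⟨q, hqU, hqP, hq⟩
  · intro T _ q hq hli
    exact ⟨q, hq, LinearIndependent.of_comp dualToVec hli⟩
  · intro F hF q hq
    ext i
    rw [commMatrix_mulVec_fgradAt, (hsub hF).2 i q hq, neg_zero, Pi.zero_apply]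

theorem localNumberIs_of_grad (b : Basis ι 𝕜 L) {N : ℕ}
    (hU : ∃ p, finrank 𝕜 (LinearMap.ker (commMatrix b p).mulVecLin) ≤ N)
    (hL : ∃ p, N ≤ finrank 𝕜 (Submodule.span 𝕜 (gradAt p '' polyInvariants b))) :
    LocalNumberIs b N := fun _ hUo hUc =>
  numberIs_of_subset_localInvariants b hU hL hUo hUc.nonempty subset_rfl fun F hF =>
    ⟨(AnalyticOnNhd.eval_mvPolynomial F).mono (Set.subset_univ _),
      fun i q _ => generatorAt_eval b hF i q⟩

lemma vecMul_ad (b : Basis ι 𝕜 L) (q : ι → 𝕜) (i j : ι) :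
    Matrix.vecMul q (LinearMap.toMatrix b b (LieAlgebra.ad 𝕜 L (b i))) j = commMatrix b q i j := by
  simp [Matrix.vecMul, dotProduct, commMatrix, LinearMap.toMatrix_apply, structConst, mul_comm]

lemma fderiv_vecMul_ad (b : Basis ι 𝕜 L) (q : ι → 𝕜) (F : (ι → 𝕜) → 𝕜) (i : ι) :
    fderiv 𝕜 F q (Matrix.vecMul q (LinearMap.toMatrix b b (LieAlgebra.ad 𝕜 L (b i)))) =
      -generatorAt b i F q := by
  rw [fderiv_apply_eq_sum, ← commMatrix_mulVec_fgradAt]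
  simp [vecMul_ad, Matrix.mulVec, dotProduct]

lemma hasDerivAt_vecMul_exp (M : Matrix ι ι 𝕜) (p : ι → 𝕜) (t : 𝕜) :
    HasDerivAt (fun s : 𝕜 => Matrix.vecMul p (NormedSpace.exp (s • M)))
      (Matrix.vecMul (Matrix.vecMul p (NormedSpace.exp (t • M))) M) t := by
  open scoped Matrix.Norms.Operator in
  have h : HasDerivAt (fun s : 𝕜 => NormedSpace.exp (s • M)) (NormedSpace.exp (t • M) * M) t :=
    hasDerivAt_exp_smul_const M t
  let φ : Matrix ι ι 𝕜 →L[𝕜] (ι → 𝕜) := LinearMap.toContinuousLinearMap (Matrix.vecMulBilin 𝕜 𝕜 p)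
  rw [Matrix.vecMul_vecMul]
  exact φ.hasFDerivAt.comp_hasDerivAt t h

lemma coadjoint_eq (g : Matrix.GeneralLinearGroup ι 𝕜) (M : Matrix ι ι 𝕜)
    (hg : (g : Matrix ι ι 𝕜) = NormedSpace.exp M) (p : ι → 𝕜) :
    coadjoint g p = Matrix.vecMul p (NormedSpace.exp (-M)) := by
  rw [coadjoint, Matrix.coe_units_inv, hg, Matrix.exp_neg]

/-- The generator is, up to sign, the derivative of `F` at `t = 0` along the orbit curve `p * exp (t
• ad (b i))`, on which `F` is constant. -/
lemma generatorAt_eq_zero_of_invariant (b : Basis ι 𝕜 L) {F : (ι → 𝕜) → 𝕜}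
    (hF : Differentiable 𝕜 F) (hinv : ∀ g ∈ adjointGroup b, ∀ p, F (coadjoint g p) = F p)
    (i : ι) (p : ι → 𝕜) : generatorAt b i F p = 0 := by
  set M := LinearMap.toMatrix b b (LieAlgebra.ad 𝕜 L (b i)) with hM
  have hconst : ∀ t : 𝕜, F (Matrix.vecMul p (NormedSpace.exp (t • M))) = F p := fun t => by
    -- The minus sign compensates for the inverse in `coadjoint`.
    let g : Matrix.GeneralLinearGroup ι 𝕜 := (Matrix.isUnit_exp (-(t • M))).unit
    have hg : (g : Matrix ι ι 𝕜) = NormedSpace.exp (-(t • M)) := IsUnit.unit_spec _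
    have hmem : g ∈ adjointGroup b :=
      Subgroup.subset_closure ⟨-(t • b i), by rw [hg, map_neg, map_smul, map_neg, map_smul]⟩
    rw [← hinv g hmem p, coadjoint_eq g _ hg, neg_neg]
  have h1 := hasDerivAt_vecMul_exp M p 0
  have h0 : Matrix.vecMul p (NormedSpace.exp ((0 : 𝕜) • M)) = p := by
    rw [zero_smul, NormedSpace.exp_zero, Matrix.vecMul_one]
  have h2 := HasFDerivAt.comp_hasDerivAt (0 : 𝕜)
    (hF (Matrix.vecMul p (NormedSpace.exp ((0 : 𝕜) • M)))).hasFDerivAt h1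
  have h3 : (F ∘ fun t : 𝕜 => Matrix.vecMul p (NormedSpace.exp (t • M))) = fun _ => F p :=
    funext hconst
  rw [h3, h0] at h2
  have h4 := h2.unique (hasDerivAt_const (0 : 𝕜) (F p))
  rwa [fderiv_vecMul_ad, neg_eq_zero] at h4

lemma coadjoint_mul (g h : Matrix.GeneralLinearGroup ι 𝕜) (p : ι → 𝕜) :
    coadjoint (g * h) p = coadjoint g (coadjoint h p) := by
  simp only [coadjoint, mul_inv_rev, Units.val_mul, Matrix.vecMul_vecMul]

/-- Integrating instead of differentiating: `F` has zero derivative along every curve `p * exp (t •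
ad x)`, so each generator of the group preserves it. -/
lemma invariant_of_generatorAt_eq_zero (b : Basis ι 𝕜 L) {F : (ι → 𝕜) → 𝕜}
    (hF : Differentiable 𝕜 F) (hgen : ∀ i p, generatorAt b i F p = 0)
    {g : Matrix.GeneralLinearGroup ι 𝕜} (hg : g ∈ adjointGroup b) (p : ι → 𝕜) :
    F (coadjoint g p) = F p := by
  have hx : ∀ (x : L) (q : ι → 𝕜),
      fderiv 𝕜 F q (Matrix.vecMul q (LinearMap.toMatrix b b (LieAlgebra.ad 𝕜 L x))) = 0 := by
    intro x q
    conv_lhs => rw [← b.sum_repr x]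
    simp only [map_sum, map_smul, Matrix.vecMul_sum, Matrix.vecMul_smul, fderiv_vecMul_ad, hgen,
      neg_zero, smul_zero, Finset.sum_const_zero]
  induction hg using Subgroup.closure_induction generalizing p with
  | mem g hg =>
    obtain ⟨x, hx'⟩ := hg
    set M := LinearMap.toMatrix b b (LieAlgebra.ad 𝕜 L x) with hM
    have hd : ∀ t : 𝕜, HasDerivAt (F ∘ fun s : 𝕜 => Matrix.vecMul p (NormedSpace.exp (s • M)))
        0 t := fun t => by
      have h := HasFDerivAt.comp_hasDerivAt t
        (hF (Matrix.vecMul p (NormedSpace.exp (t • M)))).hasFDerivAt (hasDerivAt_vecMul_exp M p t)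
      rwa [hM, hx] at h
    -- The time `-1` is the one reached by `coadjoint g`, as `g = exp M` acts through `exp (-M)`.
    have h := is_const_of_deriv_eq_zero (fun t => (hd t).differentiableAt)
      (fun t => (hd t).deriv) (-1) 0
    simp only [Function.comp_apply, zero_smul, NormedSpace.exp_zero, Matrix.vecMul_one,
      neg_smul, one_smul] at h
    rw [coadjoint_eq g M hx', h]
  | one => simp [coadjoint]
  | mul g h _ _ hg hh => rw [coadjoint_mul, hg, hh]
  | inv g _ hg => rw [← hg, ← coadjoint_mul, mul_inv_cancel]; simp [coadjoint]

theorem analyticNumberIs_of_grad (b : Basis ι 𝕜 L) {N : ℕ}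
    (hU : ∃ p, finrank 𝕜 (LinearMap.ker (commMatrix b p).mulVecLin) ≤ N)
    (hL : ∃ p, N ≤ finrank 𝕜 (Submodule.span 𝕜 (gradAt p '' polyInvariants b))) :
    AnalyticNumberIs b N := by
  refine numberIs_of_subset_localInvariants b hU hL isOpen_univ Set.univ_nonempty ?_ ?_
  · rintro F ⟨hF, hinv⟩
    exact ⟨hF, fun i p _ => generatorAt_eq_zero_of_invariant b
      (fun q => (hF q trivial).differentiableAt) hinv i p⟩
  · intro F hF
    have han := AnalyticOnNhd.eval_mvPolynomial F
    exact ⟨han, fun g hg p => invariant_of_generatorAt_eq_zero b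
      (fun q => (han q trivial).differentiableAt) (fun i q => generatorAt_eval b hF i q) hg p⟩

end AnalyticFunctions

end CoadjointInvariants

/-! ### Irreducible representations of `sl₂` over a field of characteristic zero -/

namespace CoadjointInvariants

open Module

section Sl2Module

variable {K M : Type*} [Field K] [CharZero K] [AddCommGroup M] [Module K M] [FiniteDimensional K M]

/-- The powers `E ^ n` are eigenvectors of `ad H` on the finite-dimensional space `End K M`, with
distinct eigenvalues `n * c`, so only finitely many can be non-zero. No eigenvalue of `H` in `K` is
needed. -/
lemma exists_pow_eq_zero_of_commutator (E H : End K M) {c : K} (hc : c ≠ 0)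
    (h : H * E - E * H = c • E) : ∃ n, E ^ n = 0 := by
  by_contra! hne
  have hpow : ∀ n : ℕ, H * E ^ n - E ^ n * H = (n * c) • E ^ n := by
    intro n
    induction n with
    | zero => simp
    | succ n ih =>
      have h1 : H * E ^ (n + 1) - E ^ (n + 1) * H =
          (H * E ^ n - E ^ n * H) * E + E ^ n * (H * E - E * H) := by
        rw [pow_succ]; noncomm_ring
      rw [h1, ih, h, smul_mul_assoc, mul_smul_comm, ← pow_succ, ← add_smul]
      push_cast; ring_nf
  let T : End K (End K M) := LinearMap.mulLeft K H - LinearMap.mulRight K H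
  have hinj : Function.Injective fun n : ℕ => (n : K) * c := fun a b hab => by
    simpa [hc] using hab
  have hli := T.eigenvectors_linearIndependent' (fun n : ℕ => (n : K) * c) hinj (fun n => E ^ n)
    fun n => ⟨by simpa [T, Module.End.mem_eigenspace_iff] using hpow n, hne n⟩
  exact Infinite.not_finite hli.finite

lemma map_pow_of_commutator {M : Type*} [AddCommGroup M] [Module K M] (F H : End K M)
    (hF : H * F - F * H = -(2 : K) • F) (n : ℕ) (w : M) :
    H ((F ^ n) w) = (F ^ n) (H w) - (2 * n : K) • (F ^ n) w := by
  induction n with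
  | zero => simp
  | succ n ih =>
    have h1 := LinearMap.congr_fun hF ((F ^ n) w)
    simp only [LinearMap.sub_apply, Module.End.mul_apply, LinearMap.smul_apply] at h1
    rw [sub_eq_iff_eq_add] at h1
    simp only [pow_succ', Module.End.mul_apply]
    rw [h1, ih, map_sub, map_smul]
    push_cast
    module

lemma map_pow_succ_of_commutator {M : Type*} [AddCommGroup M] [Module K M] (E F H : End K M)
    (hF : H * F - F * H = -(2 : K) • F) (hEF : E * F - F * E = H) (n : ℕ) {w : M} (hw : E w = 0) :
    E ((F ^ (n + 1)) w) = ((n : K) + 1) • ((F ^ n) (H w) - (n : K) • (F ^ n) w) := by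
  have h1 : ∀ x, E (F x) = F (E x) + H x := fun x => by
    have := LinearMap.congr_fun hEF x
    simp only [LinearMap.sub_apply, Module.End.mul_apply] at this
    rw [← this]; abel
  induction n with
  | zero => simp [h1, hw]
  | succ n ih =>
    rw [pow_succ' F (n + 1), Module.End.mul_apply, h1, ih, map_pow_of_commutator F H hF]
    simp only [map_smul, map_sub, pow_succ', Module.End.mul_apply]
    push_cast
    module

/-- A lowest weight vector exists in every finite-dimensional representation of `sl₂`, over any
field of characteristic zero. -/
lemma exists_lowest_weight_vector [Nontrivial M] (E F H : End K M)
    (hE : H * E - E * H = (2 : K) • E) (hF : H * F - F * H = -(2 : K) • F)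
    (hEF : E * F - F * E = H) :
    ∃ (v : M) (μ : K), v ≠ 0 ∧ F v = 0 ∧ H v = μ • v := by
  obtain ⟨k, hk⟩ := exists_pow_eq_zero_of_commutator E H two_ne_zero hE
  obtain ⟨l, hl⟩ := exists_pow_eq_zero_of_commutator F H (neg_ne_zero.2 two_ne_zero) hF
  have hker : ∃ w, w ≠ 0 ∧ E w = 0 := by
    obtain ⟨x, hx⟩ := exists_ne (0 : M)
    obtain ⟨n, hn, hn'⟩ := Nat.exists_not_and_succ_of_not_zero_of_exists
      (p := fun n => (E ^ n) x = 0) (by simpa using hx) ⟨k, by simp [hk]⟩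
    exact ⟨_, hn, by rwa [pow_succ', Module.End.mul_apply] at hn'⟩
  -- `n` is the last exponent for which `F ^ n` does not annihilate the kernel of `E`.
  obtain ⟨n, hn, hn'⟩ := Nat.exists_not_and_succ_of_not_zero_of_exists
    (p := fun n => ∀ w, E w = 0 → (F ^ n) w = 0)
    (by simpa [and_comm] using hker) ⟨l, by simp [hl]⟩
  push Not at hn
  obtain ⟨w, hw, hw'⟩ := hn
  -- As `F ^ (n + 1)` kills `w`, the formula forces `F ^ n (H w) = n • F ^ n w`. Hence `F ^ n w` is
  -- a weight vector of weight `n - 2 * n = -n`, although `w` itself need not be one.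
  have h1 := map_pow_succ_of_commutator E F H hF hEF n hw
  rw [hn' w hw, map_zero, eq_comm, smul_eq_zero_iff_right (Nat.cast_add_one_ne_zero n),
    sub_eq_zero] at h1
  refine ⟨_, -(n : K), hw', by simpa [pow_succ'] using hn' w hw, ?_⟩
  rw [map_pow_of_commutator F H hF, h1]
  module

/-- The classification of the irreducible representations of `sl₂`. -/
theorem exists_standard_basis [Nontrivial M] (E F H : End K M)
    (hE : H * E - E * H = (2 : K) • E) (hF : H * F - F * H = -(2 : K) • F)
    (hEF : E * F - F * E = H)
    (hirr : ∀ W : Submodule K M, (∀ v ∈ W, E v ∈ W) → (∀ v ∈ W, F v ∈ W) → (∀ v ∈ W, H v ∈ W) →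
      W = ⊥ ∨ W = ⊤) :
    ∃ (m : ℕ) (a : ℕ → M), (∃ B : Basis (Fin (m + 1)) K M, ∀ i, B i = a i) ∧ a (m + 1) = 0 ∧
      (∀ i : ℕ, H (a i) = ((m : K) - 2 * i) • a i) ∧
      (∀ i : ℕ, F (a i) = -((i : K) + 1) • a (i + 1)) ∧ E (a 0) = 0 ∧
      ∀ i : ℕ, E (a (i + 1)) = -((m : K) - i) • a i := by
  -- Interchanging `E` and `F` and negating `H` turns lowest into highest weight vectors.
  obtain ⟨v, μ, hv, hEv, hHv⟩ := exists_lowest_weight_vector F E (-H)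
    (by rw [neg_mul, mul_neg, sub_neg_eq_add, neg_add_eq_sub, ← neg_sub, hF, neg_smul, neg_neg])
    (by rw [neg_mul, mul_neg, sub_neg_eq_add, neg_add_eq_sub, ← neg_sub, hE, neg_smul])
    (by rw [← hEF, neg_sub])
  rw [LinearMap.neg_apply, neg_eq_iff_eq_neg, ← neg_smul] at hHv
  obtain ⟨l, hl⟩ := exists_pow_eq_zero_of_commutator F H (neg_ne_zero.2 two_ne_zero) hF
  obtain ⟨m, hm, hm'⟩ := Nat.exists_not_and_succ_of_not_zero_of_exists
      (p := fun n => (F ^ n) v = 0) (by simpa using hv) ⟨l, by simp [hl]⟩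
  have hEu : ∀ n : ℕ, E ((F ^ (n + 1)) v) = (((n : K) + 1) * (-μ - n)) • (F ^ n) v := fun n => by
    rw [map_pow_succ_of_commutator E F H hF hEF n hEv, hHv, map_smul]; module
  -- Applying `E` to `F ^ (m + 1) v = 0`, with `F ^ m v ≠ 0`, identifies the highest weight.
  have hμ : -μ = m := by
    have h := hEu m
    rw [hm', map_zero, eq_comm, smul_eq_zero] at h
    have h2 := (mul_eq_zero.1 (h.resolve_right hm)).resolve_left (Nat.cast_add_one_ne_zero m)
    exact sub_eq_zero.1 h2
  rw [hμ] at hHv hEu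
  have hHu : ∀ n : ℕ, H ((F ^ n) v) = ((m : K) - 2 * n) • (F ^ n) v := fun n => by
    rw [map_pow_of_commutator F H hF, hHv, map_smul]; module
  have hne : ∀ i ≤ m, (F ^ i) v ≠ 0 := fun i hi h0 => hm (by
    rw [← Nat.sub_add_cancel hi, pow_add, Module.End.mul_apply, h0, map_zero])
  -- With this scaling the `a i` transform exactly like the coefficients of `X ^ i` in a binary form
  -- of degree `m`; compare `rootE_rootCoeff`, where the root translations play the part of `F`.
  let c : ℕ → K := fun i => (-1) ^ i / (i.factorial : K)
  have hc : ∀ i, c i ≠ 0 := fun i =>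
    div_ne_zero (pow_ne_zero _ (neg_ne_zero.2 one_ne_zero)) (Nat.cast_ne_zero.2 i.factorial_ne_zero)
  have hcs : ∀ i : ℕ, c (i + 1) * ((i : K) + 1) = -c i := fun i => by
    have h1 : ((i : K) + 1) ≠ 0 := Nat.cast_add_one_ne_zero i
    have h2 : (i.factorial : K) ≠ 0 := Nat.cast_ne_zero.2 i.factorial_ne_zero
    simp only [c, Nat.factorial_succ, Nat.cast_mul, Nat.cast_succ, pow_succ]
    field_simp
  let a : ℕ → M := fun i => c i • (F ^ i) v
  have hHa : ∀ i : ℕ, H (a i) = ((m : K) - 2 * i) • a i := fun i => by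
    simp only [a, map_smul, hHu, smul_comm (c i)]
  have hFa : ∀ i : ℕ, F (a i) = -((i : K) + 1) • a (i + 1) := fun i => by
    simp only [a, map_smul, smul_smul, pow_succ', Module.End.mul_apply]
    rw [neg_mul, mul_comm, hcs, neg_neg]
  have hEa : ∀ i : ℕ, E (a (i + 1)) = -((m : K) - i) • a i := fun i => by
    simp only [a, map_smul, hEu, smul_smul]
    rw [← mul_assoc, hcs]; ring_nf
  have hlast : a (m + 1) = 0 := by simp only [a, hm', smul_zero]
  have hE0 : E (a 0) = 0 := by simp [a, hEv]
  have hli : LinearIndependent K fun i : Fin (m + 1) => a i := by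
    refine H.eigenvectors_linearIndependent' (fun i : Fin (m + 1) => (m : K) - 2 * (i : ℕ)) ?_ _ ?_
    · intro i j hij
      simpa [Fin.ext_iff] using hij
    · intro i
      exact ⟨Module.End.mem_eigenspace_iff.2 (hHa i),
        smul_ne_zero (hc i) (hne i (Nat.lt_succ_iff.1 i.2))⟩
  have hmem : ∀ i, a i ∈ Submodule.span K (Set.range fun i : Fin (m + 1) => a i) := by
    intro i
    by_cases hi : i < m + 1
    · exact Submodule.subset_span ⟨⟨i, hi⟩, rfl⟩
    · have : a i = 0 := by
        simp only [a]
        rw [← Nat.sub_add_cancel (not_lt.1 hi), pow_add, Module.End.mul_apply, hm', map_zero,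
          smul_zero]
      rw [this]; exact zero_mem _
  have hstable : ∀ T : End K M, (∀ i, T (a i) ∈ Submodule.span K (Set.range fun i : Fin (m + 1) => a i)) →
      ∀ v ∈ Submodule.span K (Set.range fun i : Fin (m + 1) => a i),
        T v ∈ Submodule.span K (Set.range fun i : Fin (m + 1) => a i) := by
    intro T hT v hv
    have : Submodule.span K (Set.range fun i : Fin (m + 1) => a i) ≤
        (Submodule.span K (Set.range fun i : Fin (m + 1) => a i)).comap T := by
      rw [Submodule.span_le]
      rintro _ ⟨i, rfl⟩
      exact hT i
    exact this hv
  have htop : Submodule.span K (Set.range fun i : Fin (m + 1) => a i) = ⊤ := by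
    refine (hirr _ (hstable E ?_) (hstable F ?_) (hstable H ?_)).resolve_left ?_
    · rintro (_ | i)
      · rw [hE0]; exact zero_mem _
      · rw [hEa]; exact Submodule.smul_mem _ _ (hmem i)
    · intro i; rw [hFa]; exact Submodule.smul_mem _ _ (hmem _)
    · intro i; rw [hHa]; exact Submodule.smul_mem _ _ (hmem _)
    · intro hbot
      have h0 := hmem 0
      rw [hbot, Submodule.mem_bot] at h0
      exact smul_ne_zero (hc 0) (hne 0 (Nat.zero_le m)) h0
  exact ⟨m, a, ⟨Basis.mk hli htop.ge, fun i => by simp⟩, hlast, hHa, hFa, hE0, hEa⟩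

end Sl2Module

/-- A basis of `L` adapted to a decomposition `L = sl₂ ⊕ V` with `V` an abelian ideal on which
`sl₂` acts by the irreducible representation with highest weight `m`. -/
structure StandardFrame (K L : Type*) [Field K] [LieRing L] [LieAlgebra K L] (m : ℕ) where
  e : L
  h : L
  f : L
  a : ℕ → L
  basis : Basis (Fin 3 ⊕ Fin (m + 1)) K L
  basis_inl : ∀ i, basis (Sum.inl i) = ![e, h, f] i
  basis_inr : ∀ i, basis (Sum.inr i) = a i
  lie_h_e : ⁅h, e⁆ = (2 : K) • e
  lie_h_f : ⁅h, f⁆ = -(2 : K) • f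
  lie_e_f : ⁅e, f⁆ = h
  lie_a_a : ∀ i j, ⁅a i, a j⁆ = 0
  lie_h_a : ∀ i, ⁅h, a i⁆ = ((m : K) - 2 * i) • a i
  lie_f_a : ∀ i, ⁅f, a i⁆ = -((i : K) + 1) • a (i + 1)
  lie_e_a_zero : ⁅e, a 0⁆ = 0
  lie_e_a_succ : ∀ i, ⁅e, a (i + 1)⁆ = -((m : K) - i) • a i
  a_last : a (m + 1) = 0

/-! ### Reduction of the semi-direct sum to a standard frame -/

section SemiDirect

open LieAlgebra LieAlgebra.SpecialLinear

variable {K R : Type*} [Field K] [CharZero K] [LieRing R] [LieAlgebra K R]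

-- Derivations preserve the span of the brackets, so `[R, R]` is `0` or `R` by irreducibility;
-- solvability excludes `R`.
omit [CharZero K] in
lemma isLieAbelian_of_irreducible [IsSolvable R] (π : sl (Fin 2) K →ₗ⁅K⁆ LieDerivation K R R)
    (h : IsIrreducibleRep π) : IsLieAbelian R := by
  have := h.1
  have hlt := derivedSeries_lt_top_of_solvable K R
  have hd : ∀ x y : R, ⁅x, y⁆ ∈ derivedSeries K R 1 := fun x y => by
    rw [derivedSeries_def, derivedSeriesOfIdeal_succ, derivedSeriesOfIdeal_zero]
    exact LieSubmodule.lie_mem_lie (LieSubmodule.mem_top x) (LieSubmodule.mem_top y)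
  have hspan : (derivedSeries K R 1).toSubmodule =
      Submodule.span K {z | ∃ x y : R, ⁅x, y⁆ = z} := by
    rw [derivedSeries_def, derivedSeriesOfIdeal_succ, derivedSeriesOfIdeal_zero,
      LieSubmodule.lieIdeal_oper_eq_linear_span']
    simp
  have hst : ∀ s, ∀ v ∈ (derivedSeries K R 1).toSubmodule,
      π s v ∈ (derivedSeries K R 1).toSubmodule := by
    intro s v hv
    rw [hspan] at hv
    have hle : Submodule.span K {z | ∃ x y : R, ⁅x, y⁆ = z} ≤
        (derivedSeries K R 1).toSubmodule.comap (π s : R →ₗ[K] R) := by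
      rw [Submodule.span_le]
      rintro _ ⟨x, y, rfl⟩
      simp only [Submodule.comap_coe, Set.mem_preimage, LieDerivation.coeFn_coe, SetLike.mem_coe,
        LieDerivation.apply_lie_eq_add]
      exact add_mem (hd _ _) (hd _ _)
    exact hle hv
  rcases h.2 _ hst with h0 | h1
  · refine ⟨fun x y => ?_⟩
    have := hd x y
    rw [← LieSubmodule.mem_toSubmodule, h0] at this
    simpa using this
  · exact absurd ((LieSubmodule.toSubmodule_eq_top _).1 h1) hlt.ne

lemma exists_standardFrame [FiniteDimensional K R] [IsSolvable R]
    (π : sl (Fin 2) K →ₗ⁅K⁆ LieDerivation K R R) (h : IsIrreducibleRep π) :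
    ∃ m, finrank K R = m + 1 ∧ Nonempty (StandardFrame K (SemiDirectSum R (sl (Fin 2) K) π) m) := by
  have := h.1
  have := isLieAbelian_of_irreducible π h
  let e : sl (Fin 2) K := single 0 1 (by decide) 1
  let f : sl (Fin 2) K := single 1 0 (by decide) 1
  let t : sl (Fin 2) K := singleSubSingle 0 1 1
  have hte : ⁅t, e⁆ = (2 : K) • e := by
    ext i j; fin_cases i <;> fin_cases j <;>
      simp [t, e, Ring.lie_def, Matrix.mul_apply, Matrix.single_apply]
    norm_num
  have htf : ⁅t, f⁆ = -(2 : K) • f := by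
    ext i j; fin_cases i <;> fin_cases j <;>
      simp [t, f, Ring.lie_def, Matrix.mul_apply, Matrix.single_apply]
    norm_num
  have hef : ⁅e, f⁆ = t := by
    ext i j; fin_cases i <;> fin_cases j <;>
      simp [t, e, f, Ring.lie_def]
  have hdecomp : ∀ s : sl (Fin 2) K, s = s.1 0 1 • e + s.1 0 0 • t + s.1 1 0 • f := by
    intro s
    have htr : s.1 0 0 + s.1 1 1 = 0 := by
      have := LinearMap.mem_ker.1 s.2
      simpa [Matrix.trace_fin_two] using this
    ext i j; fin_cases i <;> fin_cases j <;> simp [t, e, f]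
    linear_combination htr
  let ρ : sl (Fin 2) K → End K R := fun s => (π s : R →ₗ[K] R)
  have hρ : ∀ x y, ρ x * ρ y - ρ y * ρ x = ρ ⁅x, y⁆ := fun x y => by
    ext v; simp [ρ, Ring.lie_def]
  have hρs : ∀ (c : K) x, ρ (c • x) = c • ρ x := fun c x => by
    ext v; simp [ρ]
  obtain ⟨m, a, ⟨B, hB⟩, hlast, hH, hF, hE0, hE⟩ := exists_standard_basis (ρ e) (ρ f) (ρ t)
    (by rw [hρ, hte, hρs]) (by rw [hρ, htf, hρs]) (by rw [hρ, hef]) (by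
      intro W h1 h2 h3
      refine h.2 W fun s v hv => ?_
      rw [hdecomp s]
      simp only [map_add, map_smul, LieDerivation.coe_add, LieDerivation.coe_smul, Pi.add_apply,
        Pi.smul_apply]
      exact add_mem (add_mem (W.smul_mem _ (h1 v hv)) (W.smul_mem _ (h3 v hv)))
        (W.smul_mem _ (h2 v hv)))
  have hliS : LinearIndependent K ![e, t, f] := by
    rw [Fintype.linearIndependent_iff]
    intro c hc
    have hc' : ∀ i j, ((∑ k, c k • ![e, t, f] k : sl (Fin 2) K) : Matrix (Fin 2) (Fin 2) K) i j = 0 :=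
      fun i j => by rw [hc]; rfl
    have h01 := hc' 0 1
    have h00 := hc' 0 0
    have h10 := hc' 1 0
    simp [Fin.sum_univ_three, e, t, f] at h01 h00 h10
    intro i
    fin_cases i <;> assumption
  have hspS : ⊤ ≤ Submodule.span K (Set.range ![e, t, f]) := by
    intro s _
    rw [hdecomp s]
    have hm : ∀ i, ![e, t, f] i ∈ Submodule.span K (Set.range ![e, t, f]) := fun i =>
      Submodule.subset_span ⟨i, rfl⟩
    exact add_mem (add_mem (Submodule.smul_mem _ _ (hm 0)) (Submodule.smul_mem _ _ (hm 1)))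
      (Submodule.smul_mem _ _ (hm 2))
  have hact : ∀ s r, ⁅SemiDirectSum.inr π s, SemiDirectSum.inl π r⁆ = SemiDirectSum.inl π (π s r) :=
    fun s r => by simp
  refine ⟨m, by rw [finrank_eq_card_basis B, Fintype.card_fin], ⟨
    { e := SemiDirectSum.inr π e
      h := SemiDirectSum.inr π t
      f := SemiDirectSum.inr π f
      a := fun i => SemiDirectSum.inl π (a i)
      -- The frame lists `sl₂` first and the module second, the semi-direct sum the other way round;
      -- hence `prodComm`.
      basis := ((Basis.mk hliS hspS).prod B).map
        ((LinearEquiv.prodComm K _ _).trans (SemiDirectSum.toProdl π).symm)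
      basis_inl := ?_
      basis_inr := ?_
      lie_h_e := by rw [← LieHom.map_lie, hte, map_smul]
      lie_h_f := by rw [← LieHom.map_lie, htf, map_smul]
      lie_e_f := by rw [← LieHom.map_lie, hef]
      lie_a_a := fun i j => by rw [← LieHom.map_lie, trivial_lie_zero, map_zero]
      lie_h_a := fun i => ?_
      lie_f_a := fun i => ?_
      lie_e_a_zero := ?_
      lie_e_a_succ := fun i => ?_
      a_last := by rw [hlast, map_zero] }⟩⟩
  · intro i
    have hb : ((Basis.mk hliS hspS).prod B) (Sum.inl i) = (![e, t, f] i, 0) := by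
      ext <;> simp
    rw [Basis.map_apply, hb]
    fin_cases i <;> rfl
  · intro i
    have hb : ((Basis.mk hliS hspS).prod B) (Sum.inr i) = (0, a i) := by
      ext <;> simp [hB]
    rw [Basis.map_apply, hb]
    rfl
  · rw [hact, ← map_smul]
    exact congr_arg _ (hH i)
  · rw [hact, ← map_smul]
    exact congr_arg _ (hF i)
  · rw [hact, ← map_zero (SemiDirectSum.inl π)]
    exact congr_arg _ hE0
  · rw [hact, ← map_smul]
    exact congr_arg _ (hE i)

end SemiDirect

end CoadjointInvariants

/-! ### The symmetric algebra of `L` and the form `φ ⁅x, y⁆` -/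

namespace CoadjointInvariants

open MvPolynomial Module

lemma derivation_sum_apply {R A M κ : Type*} [CommSemiring R] [CommSemiring A] [AddCommMonoid M]
    [Algebra R A] [Module A M] [Module R M] (s : Finset κ) (D : κ → Derivation R A M) (x : A) :
    (∑ k ∈ s, D k) x = ∑ k ∈ s, D k x := by
  classical
  induction s using Finset.induction_on with
  | empty => simp
  | insert k s hk ih => rw [Finset.sum_insert hk, Finset.sum_insert hk, Derivation.add_apply, ih]

section LinForm

variable {ι K L : Type*} [Fintype ι] [Field K] [LieRing L] [LieAlgebra K L]

/-- An element of `L` as a linear form on the dual space of `L`. -/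
noncomputable def linForm (b : Basis ι K L) : L →ₗ[K] MvPolynomial ι K :=
  (Fintype.linearCombination K fun i => (X i : MvPolynomial ι K)) ∘ₗ b.equivFun.toLinearMap

/-- The derivation of the symmetric algebra of `L` that extends `ad x`. -/
noncomputable def lieDer (b : Basis ι K L) (x : L) :
    Derivation K (MvPolynomial ι K) (MvPolynomial ι K) :=
  mkDerivation K fun j => linForm b ⁅x, b j⁆

lemma linForm_basis (b : Basis ι K L) (i : ι) : linForm b (b i) = X i := by
  classical
  simp [linForm, Fintype.linearCombination_apply, Finsupp.single_apply]

lemma linForm_eq_sum (b : Basis ι K L) (y : L) : linForm b y = ∑ k, C (b.repr y k) * X k := by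
  simp [linForm, Fintype.linearCombination_apply, smul_eq_C_mul]

lemma lieDer_linForm (b : Basis ι K L) (x y : L) :
    lieDer b x (linForm b y) = linForm b ⁅x, y⁆ := by
  have h : (lieDer b x : MvPolynomial ι K →ₗ[K] MvPolynomial ι K) ∘ₗ linForm b =
      linForm b ∘ₗ (LieAlgebra.ad K L x : L →ₗ[K] L) := by
    refine b.ext fun j => ?_
    simp [linForm_basis, lieDer, mkDerivation_X]
  exact LinearMap.congr_fun h y

/-- The generators are derivations extending `-ad (b i)`, so invariance no longer depends on the
basis and can be tested on an adapted one, as in `mem_polyInvariants_of_basis`. -/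
lemma polyGenerator_eq (b : Basis ι K L) (i : ι) (F : MvPolynomial ι K) :
    polyGenerator b i F = -lieDer b (b i) F := by
  classical
  have h : (∑ j, linForm b ⁅b i, b j⁆ • pderiv j : Derivation K (MvPolynomial ι K) _) =
      lieDer b (b i) := by
    refine derivation_ext fun j => ?_
    rw [lieDer, mkDerivation_X]
    simp [derivation_sum_apply, pderiv_X, Pi.single_apply]
  rw [polyGenerator, ← h]
  simp [derivation_sum_apply, linForm_eq_sum, structConst, Finset.sum_mul]

lemma lieDer_eq_sum (b : Basis ι K L) {κ : Type*} [Fintype κ] (B : Basis κ K L) (x : L)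
    (F : MvPolynomial ι K) : lieDer b x F = ∑ k, B.repr x k • lieDer b (B k) F := by
  have h : lieDer b x = ∑ k, B.repr x k • lieDer b (B k) := by
    refine derivation_ext fun j => ?_
    simp only [derivation_sum_apply, Derivation.smul_apply, lieDer, mkDerivation_X]
    conv_lhs => rw [← B.sum_repr x]
    rw [sum_lie, map_sum]
    simp only [smul_lie, map_smul]
  rw [h]
  simp [derivation_sum_apply]

lemma mem_polyInvariants_of_basis (b : Basis ι K L) {κ : Type*} [Fintype κ] (B : Basis κ K L)
    {F : MvPolynomial ι K} (h : ∀ k, lieDer b (B k) F = 0) : F ∈ polyInvariants b := by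
  intro i
  rw [polyGenerator_eq, lieDer_eq_sum b B]
  simp [h]

/-- The point of `ι → K` that stands for the functional `φ`. -/
noncomputable def toPoint (b : Basis ι K L) (φ : L →ₗ[K] K) : ι → K := fun i => φ (b i)

lemma eval_linForm (b : Basis ι K L) (φ : L →ₗ[K] K) (y : L) :
    eval (toPoint b φ) (linForm b y) = φ y := by
  conv_rhs => rw [← b.sum_repr y, map_sum]
  simp [linForm_eq_sum, toPoint]

lemma gradAt_linForm (b : Basis ι K L) (p : ι → K) (y : L) :
    gradAt p (linForm b y) = b.equivFun y := by
  classical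
  ext j
  simp [gradAt, linForm_eq_sum, pderiv_X, Pi.single_apply]

omit [LieRing L] [LieAlgebra K L] [Fintype ι] in
lemma gradAt_add (p : ι → K) (F G : MvPolynomial ι K) :
    gradAt p (F + G) = gradAt p F + gradAt p G := by
  ext; simp [gradAt]

omit [LieRing L] [LieAlgebra K L] [Fintype ι] in
lemma gradAt_mul (p : ι → K) (F G : MvPolynomial ι K) :
    gradAt p (F * G) = eval p F • gradAt p G + eval p G • gradAt p F := by
  ext; simp [gradAt]

omit [LieRing L] [LieAlgebra K L] [Fintype ι] in
lemma gradAt_neg (p : ι → K) (F : MvPolynomial ι K) : gradAt p (-F) = -gradAt p F := by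
  ext; simp [gradAt]

omit [LieRing L] [LieAlgebra K L] [Fintype ι] in
lemma gradAt_smul (p : ι → K) (c : K) (F : MvPolynomial ι K) :
    gradAt p (c • F) = c • gradAt p F := by
  ext; simp [gradAt]

lemma commMatrix_mulVec_equivFun (b : Basis ι K L) (φ : L →ₗ[K] K) (y : L) (i : ι) :
    (commMatrix b (toPoint b φ)).mulVec (b.equivFun y) i = φ ⁅b i, y⁆ := by
  conv_rhs => rw [← b.sum_repr y]
  simp only [lie_sum, lie_smul, map_sum, map_smul, Matrix.mulVec, dotProduct, smul_eq_mul]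
  refine Finset.sum_congr rfl fun j _ => ?_
  rw [mul_comm]
  congr 1
  conv_rhs => rw [← b.sum_repr ⁅b i, b j⁆, map_sum]
  simp [commMatrix, structConst, toPoint]

/-- The kernel of the commutator matrix at `φ` is the radical of the alternating form `φ ⁅x, y⁆`.
The `N` functionals collected in `g` separate its points, which bounds its dimension. -/
lemma exists_corank_le (b : Basis ι K L) {N : ℕ} (φ : L →ₗ[K] K) (g : L →ₗ[K] (Fin N → K))
    (h : ∀ y, (∀ x : L, φ ⁅x, y⁆ = 0) → g y = 0 → y = 0) :
    ∃ p, finrank K (LinearMap.ker (commMatrix b p).mulVecLin) ≤ N := by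
  refine ⟨toPoint b φ, ?_⟩
  let T : LinearMap.ker (commMatrix b (toPoint b φ)).mulVecLin →ₗ[K] (Fin N → K) :=
    g ∘ₗ b.equivFun.symm.toLinearMap ∘ₗ Submodule.subtype _
  have hT : Function.Injective T := by
    rw [← LinearMap.ker_eq_bot, LinearMap.ker_eq_bot']
    rintro ⟨w, hw⟩ hTw
    obtain ⟨y, rfl⟩ := b.equivFun.surjective w
    have hgy : g y = 0 := by simpa [T] using hTw
    have hy : y = 0 := by
      refine h y (fun x => ?_) hgy
      have hx : (φ ∘ₗ (LieAlgebra.ad K L y : L →ₗ[K] L)) = 0 := by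
        refine b.ext fun i => ?_
        have := congr_fun (LinearMap.mem_ker.1 hw) i
        rw [Matrix.mulVecLin_apply, commMatrix_mulVec_equivFun] at this
        rw [LinearMap.comp_apply, LieAlgebra.ad_apply, ← lie_skew, map_neg, this]
        simp
      rw [← lie_skew, map_neg, neg_eq_zero]
      exact LinearMap.congr_fun hx x
    simp [hy]
  simpa using LinearMap.finrank_le_finrank_of_injective hT

lemma le_finrank_span_grad (b : Basis ι K L) {N : ℕ} {p : ι → K} (G : Fin N → MvPolynomial ι K)
    (v : Fin N → L) (hG : ∀ i, G i ∈ polyInvariants b) (hv : ∀ i, gradAt p (G i) = b.equivFun (v i))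
    (hli : LinearIndependent K v) :
    ∃ p, N ≤ finrank K (Submodule.span K (gradAt p '' polyInvariants b)) := by
  refine ⟨p, ?_⟩
  have h1 : LinearIndependent K fun i => gradAt p (G i) := by
    simp only [hv]
    exact hli.map' b.equivFun.toLinearMap (LinearEquiv.ker _)
  calc N = finrank K (Submodule.span K (Set.range fun i => gradAt p (G i))) := by
        rw [finrank_span_eq_card h1, Fintype.card_fin]
    _ ≤ _ := Submodule.finrank_mono (Submodule.span_mono (by
        rintro _ ⟨i, rfl⟩; exact ⟨_, hG i, rfl⟩))

end LinForm

/-! ### Coordinates and brackets in a standard frame -/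

namespace StandardFrame

variable {ι K L : Type*} [Fintype ι] [Field K] [CharZero K] [LieRing L] [LieAlgebra K L] {m : ℕ}
  (S : StandardFrame K L m)

/-- The coordinate of `a j`. -/
noncomputable def coordA (j : ℕ) : L →ₗ[K] K :=
  if h : j < m + 1 then S.basis.coord (Sum.inr ⟨j, h⟩) else 0

/-- The coordinates of `e`, `h` and `f`. -/
noncomputable def coordS (i : Fin 3) : L →ₗ[K] K := S.basis.coord (Sum.inl i)

omit [CharZero K] in
lemma hom_ext {V : Type*} [AddCommGroup V] [Module K V] {φ ψ : L →ₗ[K] V} (he : φ S.e = ψ S.e)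
    (hh : φ S.h = ψ S.h) (hf : φ S.f = ψ S.f) (ha : ∀ i ≤ m, φ (S.a i) = ψ (S.a i)) : φ = ψ := by
  refine S.basis.ext ?_
  rintro (i | i)
  · rw [S.basis_inl]
    fin_cases i
    · exact he
    · exact hh
    · exact hf
  · rw [S.basis_inr]
    exact ha i (Nat.lt_succ_iff.1 i.2)

omit [CharZero K] in
lemma eq_zero_of_coord {y : L} (hs : ∀ i, S.coordS i y = 0) (ha : ∀ j ≤ m, S.coordA j y = 0) :
    y = 0 := by
  refine S.basis.ext_elem ?_
  rintro (i | i)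
  · simpa [coordS] using hs i
  · have := ha i (Nat.lt_succ_iff.1 i.2)
    simpa [coordA, i.2] using this

omit [CharZero K] in
lemma coordS_inl (i j : Fin 3) : S.coordS i (![S.e, S.h, S.f] j) = if j = i then 1 else 0 := by
  rw [← S.basis_inl]
  simp [coordS, Finsupp.single_apply]

omit [CharZero K] in
@[simp] lemma coordS_e (i : Fin 3) : S.coordS i S.e = if 0 = i then 1 else 0 := S.coordS_inl i 0

omit [CharZero K] in
@[simp] lemma coordS_h (i : Fin 3) : S.coordS i S.h = if 1 = i then 1 else 0 := S.coordS_inl i 1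

omit [CharZero K] in
@[simp] lemma coordS_f (i : Fin 3) : S.coordS i S.f = if 2 = i then 1 else 0 := S.coordS_inl i 2

omit [CharZero K] in
lemma coordA_inl (i : ℕ) (j : Fin 3) : S.coordA i (![S.e, S.h, S.f] j) = 0 := by
  rw [← S.basis_inl, coordA]
  split_ifs <;> simp

omit [CharZero K] in
@[simp] lemma coordA_e (i : ℕ) : S.coordA i S.e = 0 := S.coordA_inl i 0

omit [CharZero K] in
@[simp] lemma coordA_h (i : ℕ) : S.coordA i S.h = 0 := S.coordA_inl i 1

omit [CharZero K] in
@[simp] lemma coordA_f (i : ℕ) : S.coordA i S.f = 0 := S.coordA_inl i 2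

omit [CharZero K] in
lemma coordS_a (i : Fin 3) {j : ℕ} (hj : j ≤ m + 1) : S.coordS i (S.a j) = 0 := by
  rcases hj.eq_or_lt with rfl | hj
  · rw [S.a_last, map_zero]
  · rw [show S.a j = S.basis (Sum.inr ⟨j, hj⟩) from (S.basis_inr ⟨j, hj⟩).symm]
    simp [coordS]

omit [CharZero K] in
lemma coordA_a (i : ℕ) {j : ℕ} (hj : j ≤ m + 1) :
    S.coordA i (S.a j) = if j = i ∧ i ≤ m then 1 else 0 := by
  rcases hj.eq_or_lt with rfl | hj
  · rw [S.a_last, map_zero, if_neg (by omega)]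
  · rw [show S.a j = S.basis (Sum.inr ⟨j, hj⟩) from (S.basis_inr ⟨j, hj⟩).symm, coordA]
    split_ifs with h1 h2 h2
    · obtain ⟨rfl, h2⟩ := h2
      simp
    · simp only [Basis.coord_apply, Basis.repr_self]
      rw [Finsupp.single_eq_of_ne]
      intro h
      simp only [Sum.inr.injEq, Fin.mk.injEq] at h
      omega
    · omega
    · rfl

omit [CharZero K] in
lemma lie_e_h : ⁅S.e, S.h⁆ = -(2 : K) • S.e := by
  rw [← lie_skew, S.lie_h_e, neg_smul]

omit [CharZero K] in
lemma lie_f_h : ⁅S.f, S.h⁆ = (2 : K) • S.f := by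
  rw [← lie_skew, S.lie_h_f, neg_smul, neg_neg]

omit [CharZero K] in
lemma lie_f_e : ⁅S.f, S.e⁆ = -S.h := by
  rw [← lie_skew, S.lie_e_f]

-- No bound on `k` is needed: `coordA` is zero beyond `m`, so both sides vanish for `k ≥ m`.
omit [CharZero K] in
lemma coordA_lie_e (k : ℕ) (y : L) :
    S.coordA k ⁅S.e, y⁆ = -((m : K) - k) * S.coordA (k + 1) y := by
  have h : S.coordA k ∘ₗ (LieAlgebra.ad K L S.e : L →ₗ[K] L) =
      (-((m : K) - k)) • S.coordA (k + 1) := by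
    refine S.hom_ext ?_ ?_ ?_ fun i hi => ?_
    · simp
    · simp [S.lie_e_h]
    · simp [S.lie_e_f]
    · rcases i with _ | i
      · simp [S.lie_e_a_zero, S.coordA_a]
      · simp only [LinearMap.comp_apply, LieAlgebra.ad_apply, S.lie_e_a_succ, map_smul,
          LinearMap.smul_apply, smul_eq_mul, S.coordA_a _ (show i ≤ m + 1 by omega),
          S.coordA_a _ (show i + 1 ≤ m + 1 by omega)]
        by_cases hik : i = k
        · subst hik; rw [if_pos (by omega), if_pos (by omega)]
        · rw [if_neg (by omega), if_neg (by omega), mul_zero, mul_zero]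
  exact LinearMap.congr_fun h y

omit [CharZero K] in
lemma coordA_lie_h (k : ℕ) (y : L) :
    S.coordA k ⁅S.h, y⁆ = ((m : K) - 2 * k) * S.coordA k y := by
  have h : S.coordA k ∘ₗ (LieAlgebra.ad K L S.h : L →ₗ[K] L) = ((m : K) - 2 * k) • S.coordA k := by
    refine S.hom_ext ?_ ?_ ?_ fun i hi => ?_
    · simp [S.lie_h_e]
    · simp
    · simp [S.lie_h_f]
    · simp only [LinearMap.comp_apply, LieAlgebra.ad_apply, S.lie_h_a, map_smul,
        LinearMap.smul_apply, smul_eq_mul, S.coordA_a _ (show i ≤ m + 1 by omega)]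
      by_cases hik : i = k
      · rw [hik]
      · rw [if_neg (by omega), mul_zero, mul_zero]
  exact LinearMap.congr_fun h y

-- At `k = 0` the truncated `k - 1` is harmless because the coefficient is zero; at `k = m + 1` the
-- formula would fail, the right side then involving `coordA m`.
omit [CharZero K] in
lemma coordA_lie_f {k : ℕ} (hk : k ≤ m) (y : L) :
    S.coordA k ⁅S.f, y⁆ = -(k : K) * S.coordA (k - 1) y := by
  have h : S.coordA k ∘ₗ (LieAlgebra.ad K L S.f : L →ₗ[K] L) = (-(k : K)) • S.coordA (k - 1) := by
    refine S.hom_ext ?_ ?_ ?_ fun i hi => ?_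
    · simp [S.lie_f_e]
    · simp [S.lie_f_h]
    · simp
    · simp only [LinearMap.comp_apply, LieAlgebra.ad_apply, S.lie_f_a, map_smul,
        LinearMap.smul_apply, smul_eq_mul, S.coordA_a _ (show i + 1 ≤ m + 1 by omega),
        S.coordA_a _ (show i ≤ m + 1 by omega)]
      rcases k with _ | k
      · simp
      · by_cases hik : i = k
        · subst hik; rw [if_pos (by omega), if_pos (by omega)]; push_cast; ring
        · rw [if_neg (by omega), if_neg (by omega), mul_zero, mul_zero]
  exact LinearMap.congr_fun h y

-- The `a j` commute, so only the `sl₂` components of `y` contribute.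
omit [CharZero K] in
lemma lie_a_eq {i : ℕ} (y : L) : ⁅S.a i, y⁆ =
    -(S.coordS 0 y • ⁅S.e, S.a i⁆ + S.coordS 1 y • ⁅S.h, S.a i⁆ + S.coordS 2 y • ⁅S.f, S.a i⁆) := by
  have h : (LieAlgebra.ad K L (S.a i) : L →ₗ[K] L) =
      -((S.coordS 0).smulRight ⁅S.e, S.a i⁆ + (S.coordS 1).smulRight ⁅S.h, S.a i⁆ +
        (S.coordS 2).smulRight ⁅S.f, S.a i⁆) := by
    refine S.hom_ext ?_ ?_ ?_ fun j hj => ?_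
    · simp
    · simp
    · simp
    · simp [S.lie_a_a, S.coordS_a _ (show j ≤ m + 1 by omega)]
  exact LinearMap.congr_fun h y

end StandardFrame

end CoadjointInvariants

/-! ### Coranks for all `m`, and explicit invariants for `m ≤ 2` -/

namespace CoadjointInvariants

open MvPolynomial Module

namespace StandardFrame

variable {ι K L : Type*} [Fintype ι] [Field K] [CharZero K] [LieRing L] [LieAlgebra K L] {m : ℕ}

omit [CharZero K] in
lemma coordA_lie_a (S : StandardFrame K L m) {i k : ℕ} (y : L) : S.coordA k ⁅S.a i, y⁆ =
    -(S.coordS 0 y * S.coordA k ⁅S.e, S.a i⁆ + S.coordS 1 y * S.coordA k ⁅S.h, S.a i⁆ +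
      S.coordS 2 y * S.coordA k ⁅S.f, S.a i⁆) := by
  rw [lie_a_eq]
  simp only [map_neg, map_add, map_smul, smul_eq_mul]

/-- At the functional dual to `h`, pairing with `e` and `f` kills the `f` and `e` components of a
radical element; `h` and the central `a 0` remain. -/
theorem exists_corank_le_zero (S : StandardFrame K L 0) (b : Basis ι K L) :
    ∃ p, finrank K (LinearMap.ker (commMatrix b p).mulVecLin) ≤ 2 := by
  refine exists_corank_le b (S.coordS 1) (LinearMap.pi ![S.coordS 1, S.coordA 0]) fun y hy hg => ?_
  have h1 : S.coordS 1 y = 0 := congr_fun hg 0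
  have h2 : S.coordA 0 y = 0 := congr_fun hg 1
  have he : S.coordS 1 ∘ₗ (LieAlgebra.ad K L S.e : L →ₗ[K] L) = S.coordS 2 := by
    refine S.hom_ext ?_ ?_ ?_ fun i hi => ?_
    · simp
    · simp [S.lie_e_h]
    · simp [S.lie_e_f]
    · obtain rfl : i = 0 := by omega
      simp [S.lie_e_a_zero, S.coordS_a]
  have hf : S.coordS 1 ∘ₗ (LieAlgebra.ad K L S.f : L →ₗ[K] L) = -S.coordS 0 := by
    refine S.hom_ext ?_ ?_ ?_ fun i hi => ?_
    · simp [S.lie_f_e]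
    · simp [S.lie_f_h]
    · simp
    · obtain rfl : i = 0 := by omega
      simp [S.lie_f_a, S.coordS_a]
  refine S.eq_zero_of_coord (fun i => ?_) fun j hj => ?_
  · fin_cases i
    · have := LinearMap.congr_fun hf y
      simp only [LinearMap.comp_apply, LieAlgebra.ad_apply, hy] at this
      simpa using this.symm
    · exact h1
    · have := LinearMap.congr_fun he y
      simp only [LinearMap.comp_apply, LieAlgebra.ad_apply, hy] at this
      exact this.symm
  · obtain rfl : j = 0 := by omega
    exact h2

/-- At the functional dual to `a 0`, pairing with `a 0`, `a 1`, `e`, `h` removes every component of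
a radical element except that of `f`. -/
theorem exists_corank_le_one (S : StandardFrame K L 1) (b : Basis ι K L) :
    ∃ p, finrank K (LinearMap.ker (commMatrix b p).mulVecLin) ≤ 1 := by
  refine exists_corank_le b (S.coordA 0) (LinearMap.pi ![S.coordS 2]) fun y hy hg => ?_
  have h1 : S.coordS 2 y = 0 := congr_fun hg 0
  have e0 := hy (S.a 0)
  have e1 := hy (S.a 1)
  have e2 := hy S.e
  have e3 := hy S.h
  rw [coordA_lie_a, coordA_lie_e, coordA_lie_h, coordA_lie_f _ (by omega)] at e0 e1
  rw [coordA_lie_e] at e2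
  rw [coordA_lie_h] at e3
  simp [S.coordA_a] at e0 e1 e2 e3
  refine S.eq_zero_of_coord (fun i => ?_) fun j hj => ?_
  · fin_cases i <;> assumption
  · interval_cases j <;> assumption

-- For `m = 2` the vector `a 1` has weight zero, so at its dual functional neither the `h` nor the
-- `a 1` component is detected.
omit [CharZero K] in
theorem exists_corank_le_two (S : StandardFrame K L 2) (b : Basis ι K L) :
    ∃ p, finrank K (LinearMap.ker (commMatrix b p).mulVecLin) ≤ 2 := by
  refine exists_corank_le b (S.coordA 1) (LinearMap.pi ![S.coordS 1, S.coordA 1]) fun y hy hg => ?_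
  have h1 : S.coordS 1 y = 0 := congr_fun hg 0
  have h2 : S.coordA 1 y = 0 := congr_fun hg 1
  have e0 := hy (S.a 0)
  have e1 := hy (S.a 2)
  have e2 := hy S.e
  have e3 := hy S.f
  rw [coordA_lie_a, coordA_lie_e, coordA_lie_h, coordA_lie_f _ (by omega)] at e0 e1
  rw [coordA_lie_e] at e2
  rw [coordA_lie_f _ (by omega)] at e3
  norm_num [S.coordA_a] at e0 e1 e2 e3
  refine S.eq_zero_of_coord (fun i => ?_) fun j hj => ?_
  · fin_cases i <;> assumption
  · interval_cases j <;> assumption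

/-- At the functional dual to `a 1`, the elements `f`, `h`, `e` carry `a 0`, `a 1`, `a 2`
respectively to non-zero multiples of `a 1`, because `m - 1` and `m - 2` are non-zero. Six
components of a radical element vanish, leaving `a 3, …, a m`. -/
theorem exists_corank_le_of_three_le (S : StandardFrame K L m) (hm : 3 ≤ m) (b : Basis ι K L) :
    ∃ p, finrank K (LinearMap.ker (commMatrix b p).mulVecLin) ≤ m - 2 := by
  refine exists_corank_le b (S.coordA 1) (LinearMap.pi fun i : Fin (m - 2) => S.coordA (i + 3))
    fun y hy hg => ?_
  have hm1 : 1 - (m : K) ≠ 0 := by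
    rw [sub_ne_zero]; exact_mod_cast (by omega : 1 ≠ m)
  have hm2 : (m : K) - 2 ≠ 0 := by
    rw [sub_ne_zero]; exact_mod_cast (by omega : m ≠ 2)
  have e0 := hy (S.a 0)
  have e1 := hy (S.a 1)
  have e2 := hy (S.a 2)
  have e3 := hy S.e
  have e4 := hy S.h
  have e5 := hy S.f
  rw [coordA_lie_a, coordA_lie_e, coordA_lie_h, coordA_lie_f _ (by omega)] at e0 e1 e2
  rw [coordA_lie_e] at e3
  rw [coordA_lie_h] at e4
  rw [coordA_lie_f _ (by omega)] at e5
  rw [S.coordA_a _ (by omega), S.coordA_a _ (by omega), S.coordA_a _ (by omega)] at e0 e1 e2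
  have hm' : 1 ≤ m ∧ 2 ≤ m := by omega
  simp [hm', hm1, hm2] at e0 e1 e2 e3 e4 e5
  refine S.eq_zero_of_coord (fun i => ?_) fun j hj => ?_
  · fin_cases i <;> assumption
  · rcases (by omega : j = 0 ∨ j = 1 ∨ j = 2 ∨ 3 ≤ j) with rfl | rfl | rfl | h3
    · assumption
    · assumption
    · assumption
    · have := congr_fun hg ⟨j - 3, by omega⟩
      simpa [Nat.sub_add_cancel h3] using this

omit [CharZero K] in
lemma mem_polyInvariants (S : StandardFrame K L m) (b : Basis ι K L) {F : MvPolynomial ι K}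
    (he : lieDer b S.e F = 0) (hh : lieDer b S.h F = 0) (hf : lieDer b S.f F = 0)
    (ha : ∀ i ≤ m, lieDer b (S.a i) F = 0) : F ∈ polyInvariants b := by
  refine mem_polyInvariants_of_basis b S.basis ?_
  rintro (i | i)
  · rw [S.basis_inl]
    fin_cases i
    · exact he
    · exact hh
    · exact hf
  · rw [S.basis_inr]
    exact ha i (Nat.lt_succ_iff.1 i.2)

omit [CharZero K] in
lemma lie_a_h (S : StandardFrame K L m) (i : ℕ) : ⁅S.a i, S.h⁆ = -((m : K) - 2 * i) • S.a i := by
  rw [← lie_skew, S.lie_h_a, neg_smul]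

omit [CharZero K] in
lemma lie_a_f (S : StandardFrame K L m) (i : ℕ) : ⁅S.a i, S.f⁆ = ((i : K) + 1) • S.a (i + 1) := by
  rw [← lie_skew, S.lie_f_a, neg_smul, neg_neg]

omit [CharZero K] in
lemma lie_a_e_zero (S : StandardFrame K L m) : ⁅S.a 0, S.e⁆ = 0 := by
  rw [← lie_skew, S.lie_e_a_zero, neg_zero]

omit [CharZero K] in
lemma lie_a_e_succ (S : StandardFrame K L m) (i : ℕ) :
    ⁅S.a (i + 1), S.e⁆ = ((m : K) - i) • S.a i := by
  rw [← lie_skew, S.lie_e_a_succ, neg_smul, neg_neg]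

/-- Here `L` is `sl₂` plus a line: the invariants are the central `a 0` and the Casimir element `h²
+ 4 e f`. -/
theorem exists_le_finrank_zero (S : StandardFrame K L 0) (b : Basis ι K L) :
    ∃ p, 2 ≤ finrank K (Submodule.span K (gradAt p '' polyInvariants b)) := by
  have ha1 : S.a 1 = 0 := S.a_last
  have hC2 : (C (2 : K) : MvPolynomial ι K) = 2 := map_ofNat C 2
  have hC4 : (C (4 : K) : MvPolynomial ι K) = 4 := map_ofNat C 4
  let G : Fin 2 → MvPolynomial ι K := ![linForm b (S.a 0), linForm b S.h * linForm b S.h +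
    (4 : K) • (linForm b S.e * linForm b S.f)]
  refine le_finrank_span_grad b (p := toPoint b (S.coordS 1)) G ![S.a 0, (2 : K) • S.h] ?_ ?_ ?_
  · refine Fin.forall_fin_two.2 ⟨S.mem_polyInvariants b ?_ ?_ ?_ ?_,
      S.mem_polyInvariants b ?_ ?_ ?_ ?_⟩
    all_goals try intro i hi; obtain rfl : i = 0 := by omega
    all_goals
      simp [G, Derivation.leibniz, lieDer_linForm, S.lie_e_a_zero, S.lie_h_a, S.lie_f_a,
        S.lie_h_e, S.lie_e_h, S.lie_h_f, S.lie_f_h, S.lie_f_e, S.lie_e_f, ha1,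
        S.lie_a_h, S.lie_a_f, S.lie_a_e_zero, smul_eq_C_mul]
    all_goals try simp only [hC2, hC4]
    all_goals try ring1
  · refine Fin.forall_fin_two.2 ⟨?_, ?_⟩
    · simp [G, gradAt_linForm]
    · simp [G, gradAt_linForm, gradAt_add, gradAt_mul, gradAt_smul, eval_linForm, two_smul]
  · rw [LinearIndependent.pair_iff]
    intro s t hst
    have h1 := congr_arg (S.coordA 0) hst
    have h2 := congr_arg (S.coordS 1) hst
    simp [S.coordA_a, S.coordS_a] at h1 h2
    exact ⟨h1, h2⟩

/-- The quadratic monomials in `a 0`, `a 1` span a copy of the adjoint representation; the invariant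
is its pairing with `e`, `h`, `f`. At the functional dual to `a 0` its gradient is `f`. -/
theorem exists_le_finrank_one (S : StandardFrame K L 1) (b : Basis ι K L) :
    ∃ p, 1 ≤ finrank K (Submodule.span K (gradAt p '' polyInvariants b)) := by
  have ha2 : S.a 2 = 0 := S.a_last
  have hC2 : (C (2 : K) : MvPolynomial ι K) = 2 := map_ofNat C 2
  let G : Fin 1 → MvPolynomial ι K := ![-(linForm b S.e * (linForm b (S.a 1) * linForm b (S.a 1))) +
    linForm b S.h * (linForm b (S.a 0) * linForm b (S.a 1)) +
    linForm b S.f * (linForm b (S.a 0) * linForm b (S.a 0))]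
  have he1 : ⁅S.e, S.a 1⁆ = -S.a 0 := by simpa using S.lie_e_a_succ 0
  have hae1 : ⁅S.a 1, S.e⁆ = S.a 0 := by simpa using S.lie_a_e_succ 0
  refine le_finrank_span_grad b (p := toPoint b (S.coordA 0)) G ![S.f] ?_ ?_ ?_
  · refine Fin.forall_fin_one.2 (S.mem_polyInvariants b ?_ ?_ ?_ ?_)
    all_goals try intro i hi; interval_cases i
    all_goals
      simp [G, Derivation.leibniz, lieDer_linForm, S.lie_e_a_zero, S.lie_h_a, S.lie_f_a, he1, hae1,
        S.lie_h_e, S.lie_e_h, S.lie_h_f, S.lie_f_h, S.lie_f_e, S.lie_e_f, ha2, S.lie_a_a,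
        S.lie_a_h, S.lie_a_f, S.lie_a_e_zero, smul_eq_C_mul]
    all_goals try simp only [hC2]
    all_goals try ring1
  · refine Fin.forall_fin_one.2 ?_
    simp [G, gradAt_linForm, gradAt_add, gradAt_mul, gradAt_neg, eval_linForm, S.coordA_a]
  · rw [linearIndependent_unique_iff]
    intro h
    have h1 := congr_arg (S.coordS 2) h
    simp at h1

/-- For `m = 2` the module is itself the adjoint representation: one invariant is the discriminant
`a₁² - 4 a₀ a₂`, the other the pairing of the module with `sl₂`. -/
theorem exists_le_finrank_two (S : StandardFrame K L 2) (b : Basis ι K L) :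
    ∃ p, 2 ≤ finrank K (Submodule.span K (gradAt p '' polyInvariants b)) := by
  have ha3 : S.a 3 = 0 := S.a_last
  have hC2 : (C (2 : K) : MvPolynomial ι K) = 2 := map_ofNat C 2
  have hC4 : (C (4 : K) : MvPolynomial ι K) = 4 := map_ofNat C 4
  let G : Fin 2 → MvPolynomial ι K := ![linForm b (S.a 1) * linForm b (S.a 1) +
      (-4 : K) • (linForm b (S.a 0) * linForm b (S.a 2)),
    (-2 : K) • (linForm b S.e * linForm b (S.a 2)) + linForm b S.h * linForm b (S.a 1) +
      (2 : K) • (linForm b S.f * linForm b (S.a 0))]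
  have he1 : ⁅S.e, S.a 1⁆ = -(2 : K) • S.a 0 := by simpa using S.lie_e_a_succ 0
  have hae1 : ⁅S.a 1, S.e⁆ = (2 : K) • S.a 0 := by simpa using S.lie_a_e_succ 0
  have he2 : ⁅S.e, S.a 2⁆ = -S.a 1 := by
    have := S.lie_e_a_succ 1; norm_num at this; exact this
  have hae2 : ⁅S.a 2, S.e⁆ = S.a 1 := by
    have := S.lie_a_e_succ 1; norm_num at this; exact this
  refine le_finrank_span_grad b (p := toPoint b (S.coordA 1)) G ![(2 : K) • S.a 1, S.h] ?_ ?_ ?_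
  · refine Fin.forall_fin_two.2 ⟨S.mem_polyInvariants b ?_ ?_ ?_ ?_,
      S.mem_polyInvariants b ?_ ?_ ?_ ?_⟩
    all_goals try intro i hi; interval_cases i
    all_goals
      simp [G, Derivation.leibniz, lieDer_linForm, S.lie_e_a_zero, S.lie_h_a, S.lie_f_a, he1, hae1,
        he2, hae2,
        S.lie_h_e, S.lie_e_h, S.lie_h_f, S.lie_f_h, S.lie_f_e, S.lie_e_f, ha3, S.lie_a_a,
        S.lie_a_h, S.lie_a_f, S.lie_a_e_zero, smul_eq_C_mul]
    all_goals try simp only [hC2, hC4]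
    all_goals try ring1
  · refine Fin.forall_fin_two.2 ⟨?_, ?_⟩
    · simp [G, gradAt_linForm, gradAt_add, gradAt_mul, gradAt_smul, gradAt_neg, eval_linForm, two_smul,
        S.coordA_a]
    · simp [G, gradAt_linForm, gradAt_add, gradAt_mul, gradAt_smul, gradAt_neg, eval_linForm, S.coordA_a]
  · rw [LinearIndependent.pair_iff]
    intro s t hst
    have h1 := congr_arg (S.coordA 1) hst
    have h2 := congr_arg (S.coordS 1) hst
    simp [S.coordA_a, S.coordS_a] at h1 h2
    exact ⟨h1, h2⟩

end StandardFrame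

end CoadjointInvariants

/-! ### Derivations on the roots and coefficients of a binary form -/

namespace CoadjointInvariants

open MvPolynomial

section DerivationLemmas

/-- Logarithmic derivatives add up over products. -/
lemma derivation_prod_of_eigen {R A κ : Type*} [CommRing R] [CommRing A] [Algebra R A]
    (D : Derivation R A A) (s : Finset κ) (x l : κ → A) (h : ∀ k ∈ s, D (x k) = l k * x k) :
    D (∏ k ∈ s, x k) = (∑ k ∈ s, l k) * ∏ k ∈ s, x k := by
  classical
  induction s using Finset.induction_on with
  | empty => simp
  | insert k s hk ih =>
    rw [Finset.prod_insert hk, Finset.sum_insert hk, Derivation.leibniz,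
      ih fun j hj => h j (Finset.mem_insert_of_mem hj), h k (Finset.mem_insert_self _ _)]
    simp only [smul_eq_mul]
    ring

lemma derivation_pow_of_eigen {R A : Type*} [CommRing R] [CommRing A] [Algebra R A]
    (D : Derivation R A A) {x l : A} (h : D x = l * x) (n : ℕ) :
    D (x ^ n) = (n * l) * x ^ n := by
  have := derivation_prod_of_eigen D (Finset.range n) (fun _ => x) (fun _ => l) fun _ _ => h
  simpa using this

lemma derivation_mul_of_eigen {R A : Type*} [CommRing R] [CommRing A] [Algebra R A]
    (D : Derivation R A A) {x y l k : A} (hx : D x = l * x) (hy : D y = k * y) :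
    D (x * y) = (l + k) * (x * y) := by
  rw [Derivation.leibniz, hx, hy]
  simp only [smul_eq_mul]
  ring

lemma map_derivation_eq {K σ B : Type*} [CommRing K] [CommRing B] [Algebra K B]
    (φ : MvPolynomial σ K →ₐ[K] B) (δ : Derivation K (MvPolynomial σ K) (MvPolynomial σ K))
    (D : Derivation K B B) (h : ∀ i, φ (δ (X i)) = D (φ (X i))) (F : MvPolynomial σ K) :
    φ (δ F) = D (φ F) := by
  induction F using MvPolynomial.induction_on with
  | C a =>
    rw [← algebraMap_eq, Derivation.map_algebraMap, AlgHom.commutes, Derivation.map_algebraMap,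
      map_zero]
  | add F G hF hG => simp only [map_add, hF, hG]
  | mul_X F i hF => simp only [Derivation.leibniz, map_mul, map_add, smul_eq_mul, hF, h]

/-- The derivation of `A[X]` that acts by `D` on the coefficients. -/
noncomputable def coeffDer {R A : Type*} [CommRing R] [CommRing A] [Algebra R A]
    (D : Derivation R A A) : Derivation R (Polynomial A) (Polynomial A) :=
  PolynomialModule.equivPolynomialSelf.compDer D.mapCoeffs

lemma coeff_coeffDer {R A : Type*} [CommRing R] [CommRing A] [Algebra R A]
    (D : Derivation R A A) (p : Polynomial A) (i : ℕ) :
    (coeffDer D p).coeff i = D (p.coeff i) := rfl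

lemma coeffDer_C {R A : Type*} [CommRing R] [CommRing A] [Algebra R A]
    (D : Derivation R A A) (x : A) : coeffDer D (Polynomial.C x) = Polynomial.C (D x) := by
  ext i
  rw [coeff_coeffDer, Polynomial.coeff_C, Polynomial.coeff_C]
  split_ifs <;> simp

lemma coeffDer_X {R A : Type*} [CommRing R] [CommRing A] [Algebra R A]
    (D : Derivation R A A) : coeffDer D (Polynomial.X : Polynomial A) = 0 := by
  ext i
  rw [coeff_coeffDer, Polynomial.coeff_X]
  split_ifs <;> simp

lemma eval_aeval_eq {K σ τ : Type*} [CommRing K] (g : σ → MvPolynomial τ K) (p : τ → K)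
    (F : MvPolynomial σ K) : eval p (aeval g F) = eval (fun i => eval p (g i)) F := by
  induction F using MvPolynomial.induction_on with
  | C a => simp
  | add F G hF hG => simp only [map_add, hF, hG]
  | mul_X F i hF => simp only [map_mul, hF, aeval_X, eval_X]

/-- The chain rule. -/
lemma gradAt_aeval {K σ τ : Type*} [Field K] [Fintype σ] (g : σ → MvPolynomial τ K) (p : τ → K)
    (F : MvPolynomial σ K) : gradAt p (aeval g F) =
      ∑ i, gradAt (fun i => eval p (g i)) F i • gradAt p (g i) := by
  classical
  induction F using MvPolynomial.induction_on with
  | C a => ext; simp [gradAt]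
  | add F G hF hG =>
    rw [map_add, gradAt_add, hF, hG, gradAt_add]
    simp only [Pi.add_apply, add_smul, Finset.sum_add_distrib]
  | mul_X F i hF =>
    have h1 : ∀ j, gradAt (fun i => eval p (g i)) (X i : MvPolynomial σ K) j =
        if j = i then 1 else 0 := fun j => by
      simp [gradAt, pderiv_X, Pi.single_apply, apply_ite (eval fun i => eval p (g i)), eq_comm]
    rw [map_mul, aeval_X, gradAt_mul, hF, gradAt_mul, eval_aeval_eq]
    simp [add_smul, Finset.sum_add_distrib, h1, Finset.smul_sum, smul_smul]

end DerivationLemmas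

section RootRing

variable (K : Type*) [Field K] (m : ℕ)

/-- The generic form of degree `m`, written as `A * ∏ j, (X - α j)`, where `A` and the roots `α j`
are indeterminates. -/
noncomputable def rootForm : Polynomial (MvPolynomial (Option (Fin m)) K) :=
  Polynomial.C (X none) * ∏ j, (Polynomial.X - Polynomial.C (X (some j)))

/-- The derivation corresponding to the translations of the roots. -/
noncomputable def rootE :
    Derivation K (MvPolynomial (Option (Fin m)) K) (MvPolynomial (Option (Fin m)) K) :=
  mkDerivation K fun o => o.elim 0 fun _ => 1

/-- The derivation corresponding to the homotheties of the roots. -/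
noncomputable def rootH :
    Derivation K (MvPolynomial (Option (Fin m)) K) (MvPolynomial (Option (Fin m)) K) :=
  mkDerivation K fun o => o.elim (-(m : MvPolynomial (Option (Fin m)) K) * X none) fun j =>
    2 * X (some j)

/-- The derivation corresponding to the special projective transformations of the roots. -/
noncomputable def rootF :
    Derivation K (MvPolynomial (Option (Fin m)) K) (MvPolynomial (Option (Fin m)) K) :=
  mkDerivation K fun o => o.elim ((∑ j, X (some j)) * X none) fun j => -(X (some j)) ^ 2

@[simp] lemma rootE_none : rootE K m (X none) = 0 := mkDerivation_X ..
@[simp] lemma rootE_some (j : Fin m) : rootE K m (X (some j)) = 1 := mkDerivation_X ..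
@[simp] lemma rootH_none : rootH K m (X none) = -(m : MvPolynomial (Option (Fin m)) K) * X none :=
  mkDerivation_X ..
@[simp] lemma rootH_some (j : Fin m) : rootH K m (X (some j)) = 2 * X (some j) :=
  mkDerivation_X ..
@[simp] lemma rootF_none : rootF K m (X none) = (∑ j, X (some j)) * X none := mkDerivation_X ..
@[simp] lemma rootF_some (j : Fin m) : rootF K m (X (some j)) = -(X (some j)) ^ 2 :=
  mkDerivation_X ..

/-- The coefficients of `rootForm`. -/
noncomputable def rootCoeff (i : ℕ) : MvPolynomial (Option (Fin m)) K := (rootForm K m).coeff i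

lemma rootE_rootCoeff (i : ℕ) :
    rootE K m (rootCoeff K m i) = -((i : K) + 1) • rootCoeff K m (i + 1) := by
  -- Translating the roots and the variable together fixes every factor `X - α j`, so `D` kills the
  -- form; its coefficient of `X ^ i` is the claim.
  let D : Derivation K (Polynomial (MvPolynomial (Option (Fin m)) K)) _ :=
    coeffDer (rootE K m) + Polynomial.derivative'.restrictScalars K
  have h0 : D (Polynomial.C (X none)) = 0 * Polynomial.C (X none) := by
    simp [D, coeffDer_C]
  have h1 : ∀ j ∈ Finset.univ, D (Polynomial.X - Polynomial.C (X (some j))) =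
      0 * (Polynomial.X - Polynomial.C (X (some j))) := fun j _ => by
    simp [D, coeffDer_C, coeffDer_X]
  have h2 := derivation_mul_of_eigen D h0 (derivation_prod_of_eigen D _ _ _ h1)
  have h3 := congr_arg (fun p => Polynomial.coeff p i) h2
  change Polynomial.coeff (D (rootForm K m)) i = _ at h3
  simp only [D, Derivation.add_apply, Polynomial.coeff_add, coeff_coeffDer,
    Derivation.restrictScalars_apply, Finset.sum_const_zero, add_zero, zero_mul,
    Polynomial.coeff_zero] at h3
  rw [rootCoeff, eq_neg_of_add_eq_zero_left h3]
  change -(Polynomial.derivative (rootForm K m)).coeff i = _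
  rw [Polynomial.coeff_derivative, rootCoeff, neg_smul, add_smul, one_smul, smul_eq_C_mul]
  simp
  ring

lemma rootH_rootCoeff (i : ℕ) :
    rootH K m (rootCoeff K m i) = ((m : K) - 2 * i) • rootCoeff K m i := by
  -- Each factor `X - α j` has weight `2` under `D` and the leading coefficient has weight `-m`, so
  -- the form has weight `2 * m - m = m`.
  let D : Derivation K (Polynomial (MvPolynomial (Option (Fin m)) K)) _ :=
    coeffDer (rootH K m) + (2 * Polynomial.X : Polynomial (MvPolynomial (Option (Fin m)) K)) •
      Polynomial.derivative'.restrictScalars K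
  have h0 : D (Polynomial.C (X none)) =
      (-(m : Polynomial (MvPolynomial (Option (Fin m)) K))) * Polynomial.C (X none) := by
    simp only [D, Derivation.add_apply, coeffDer_C, rootH_none]
    simp
    exact (neg_mul _ _).symm
  have h1 : ∀ j ∈ Finset.univ, D (Polynomial.X - Polynomial.C (X (some j))) =
      2 * (Polynomial.X - Polynomial.C (X (some j))) := fun j _ => by
    simp [D, coeffDer_C, coeffDer_X, map_ofNat Polynomial.C 2]
    ring
  have h2 := derivation_mul_of_eigen D h0 (derivation_prod_of_eigen D _ _ _ h1)
  have h3 := congr_arg (fun p => Polynomial.coeff p i) h2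
  change Polynomial.coeff (D (rootForm K m)) i = Polynomial.coeff (_ * rootForm K m) i at h3
  have h4 : (-(m : Polynomial (MvPolynomial (Option (Fin m)) K)) + ∑ _j : Fin m, 2) =
      Polynomial.C (C (m : K)) := by
    simp
    ring
  have h5 : (2 * Polynomial.X * Polynomial.derivative (rootForm K m)).coeff i =
      C (2 * (i : K)) * (rootForm K m).coeff i := by
    rw [← map_ofNat Polynomial.C 2, mul_assoc, Polynomial.coeff_C_mul, map_mul, map_ofNat C 2]
    cases i with
    | zero => simp
    | succ i =>
      rw [Polynomial.coeff_X_mul, Polynomial.coeff_derivative]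
      simp
      ring
  rw [h4, Polynomial.coeff_C_mul] at h3
  change (coeffDer (rootH K m) (rootForm K m) + _).coeff i = _ at h3
  rw [Polynomial.coeff_add, coeff_coeffDer] at h3
  change _ + (2 * Polynomial.X * Polynomial.derivative (rootForm K m)).coeff i = _ at h3
  rw [h5] at h3
  rw [rootCoeff, eq_sub_of_add_eq h3, smul_eq_C_mul, map_sub, sub_mul]

lemma coeffDer_rootF_rootForm : coeffDer (rootF K m) (rootForm K m) =
    Polynomial.X ^ 2 * Polynomial.derivative (rootForm K m) -
      Polynomial.X * (Polynomial.C (C (m : K)) * rootForm K m) := by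
  -- `D` multiplies `X - α j` by `-(X + α j)`; the action on the leading coefficient cancels the sum
  -- of the roots, leaving the multiplier `-m * X`.
  let D : Derivation K (Polynomial (MvPolynomial (Option (Fin m)) K)) _ :=
    coeffDer (rootF K m) - (Polynomial.X ^ 2 : Polynomial (MvPolynomial (Option (Fin m)) K)) •
      Polynomial.derivative'.restrictScalars K
  have h0 : D (Polynomial.C (X none)) =
      Polynomial.C (∑ j, X (some j)) * Polynomial.C (X none) := by
    simp [D, coeffDer_C]
  have h1 : ∀ j : Fin m, j ∈ Finset.univ → D (Polynomial.X - Polynomial.C (X (some j))) =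
      (-(Polynomial.X + Polynomial.C (X (some j) : MvPolynomial (Option (Fin m)) K))) *
        (Polynomial.X - Polynomial.C (X (some j))) := fun j _ => by
    simp [D, coeffDer_C, coeffDer_X]
    ring
  have h2 := derivation_mul_of_eigen D h0 (derivation_prod_of_eigen D _ _ _ h1)
  have h4 : Polynomial.C (∑ j, X (some j)) + ∑ j : Fin m, -(Polynomial.X +
      Polynomial.C (X (some j) : MvPolynomial (Option (Fin m)) K)) =
      -(Polynomial.X * Polynomial.C (C (m : K))) := by
    simp [Finset.sum_add_distrib, mul_comm]
  rw [h4] at h2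
  change coeffDer (rootF K m) (rootForm K m) - Polynomial.X ^ 2 *
    Polynomial.derivative (rootForm K m) = _ * rootForm K m at h2
  rw [eq_add_of_sub_eq h2]
  ring

lemma rootF_rootCoeff_zero : rootF K m (rootCoeff K m 0) = 0 := by
  rw [rootCoeff, ← coeff_coeffDer, coeffDer_rootF_rootForm]
  simp

lemma rootF_rootCoeff_succ (i : ℕ) :
    rootF K m (rootCoeff K m (i + 1)) = -((m : K) - i) • rootCoeff K m i := by
  rw [rootCoeff, ← coeff_coeffDer, coeffDer_rootF_rootForm, Polynomial.coeff_sub,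
    Polynomial.coeff_X_mul, Polynomial.coeff_C_mul, pow_two, mul_assoc, Polynomial.coeff_X_mul]
  have h : (Polynomial.X * Polynomial.derivative (rootForm K m)).coeff i =
      C (i : K) * (rootForm K m).coeff i := by
    cases i with
    | zero => simp
    | succ i =>
      rw [Polynomial.coeff_X_mul, Polynomial.coeff_derivative]
      simp
      ring
  rw [h, rootCoeff, neg_smul, smul_eq_C_mul, map_sub]
  ring

end RootRing

end CoadjointInvariants

/-! ### Descent from the roots to the coefficients -/

namespace CoadjointInvariants

open MvPolynomial

section RootAlgHom

variable (K : Type*) [Field K] (m : ℕ)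

lemma rootCoeff_sub {j : ℕ} (hj : j ≤ m) :
    rootCoeff K m (m - j) = (-1) ^ j * (X none * rename some (esymm (Fin m) K j)) := by
  have h : (∏ j : Fin m, (Polynomial.X - Polynomial.C (X (some j) :
      MvPolynomial (Option (Fin m)) K))) =
      (((Finset.univ : Finset (Fin m)).val.map fun j => (X (some j) :
        MvPolynomial (Option (Fin m)) K)).map fun t => Polynomial.X - Polynomial.C t).prod := by
    rw [Multiset.map_map]
    rfl
  rw [rootCoeff, rootForm, Polynomial.coeff_C_mul, h, Multiset.prod_X_sub_C_coeff]
  · rw [Multiset.card_map, Finset.card_val, Finset.card_univ, Fintype.card_fin, Nat.sub_sub_self hj,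
      Finset.esymm_map_val]
    simp only [esymm, map_sum, map_prod, rename_X]
    ring
  · simp

lemma rootCoeff_self : rootCoeff K m m = X none := by
  simpa using rootCoeff_sub K m (Nat.zero_le m)

lemma rootCoeff_of_lt {i : ℕ} (hi : m < i) : rootCoeff K m i = 0 := by
  refine Polynomial.coeff_eq_zero_of_natDegree_lt (lt_of_le_of_lt ?_ hi)
  refine (Polynomial.natDegree_C_mul_le _ _).trans ((Polynomial.natDegree_prod_le _ _).trans ?_)
  simp

/-- The substitution of the coefficients of `rootForm` for the variables. -/
noncomputable def rootHom : MvPolynomial (Fin (m + 1)) K →ₐ[K] MvPolynomial (Option (Fin m)) K :=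
  aeval fun i => rootCoeff K m i

/-- The variables of `MvPolynomial (Fin (m + 1)) K`, continued by zero. -/
noncomputable def coeffVar (i : ℕ) : MvPolynomial (Fin (m + 1)) K :=
  if h : i < m + 1 then X ⟨i, h⟩ else 0

lemma coeffVar_val (i : Fin (m + 1)) : coeffVar K m i = X i := dif_pos i.2

lemma rootHom_coeffVar (i : ℕ) : rootHom K m (coeffVar K m i) = rootCoeff K m i := by
  rw [coeffVar]
  split_ifs with h
  · exact aeval_X ..
  · rw [map_zero, rootCoeff_of_lt K m (by omega)]

/-- The raising operator on the polynomials in the coefficients of a form of degree `m`. -/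
noncomputable def coeffE :
    Derivation K (MvPolynomial (Fin (m + 1)) K) (MvPolynomial (Fin (m + 1)) K) :=
  mkDerivation K fun i => -((i : ℕ) + 1 : K) • coeffVar K m (i + 1)

/-- The weight operator on the polynomials in the coefficients of a form of degree `m`. -/
noncomputable def coeffH :
    Derivation K (MvPolynomial (Fin (m + 1)) K) (MvPolynomial (Fin (m + 1)) K) :=
  mkDerivation K fun i => ((m : K) - 2 * (i : ℕ)) • coeffVar K m i

/-- The lowering operator on the polynomials in the coefficients of a form of degree `m`. -/
noncomputable def coeffF :
    Derivation K (MvPolynomial (Fin (m + 1)) K) (MvPolynomial (Fin (m + 1)) K) :=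
  mkDerivation K fun i => Nat.casesOn (i : ℕ) 0 fun j => -((m : K) - j) • coeffVar K m j

lemma rootHom_coeffE (F : MvPolynomial (Fin (m + 1)) K) :
    rootHom K m (coeffE K m F) = rootE K m (rootHom K m F) := by
  refine map_derivation_eq _ _ _ (fun i => ?_) F
  rw [coeffE, mkDerivation_X, map_smul, rootHom_coeffVar, ← rootE_rootCoeff, rootHom, aeval_X]

lemma rootHom_coeffH (F : MvPolynomial (Fin (m + 1)) K) :
    rootHom K m (coeffH K m F) = rootH K m (rootHom K m F) := by
  refine map_derivation_eq _ _ _ (fun i => ?_) F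
  rw [coeffH, mkDerivation_X, map_smul, rootHom_coeffVar, ← rootH_rootCoeff, rootHom, aeval_X]

lemma rootHom_coeffF (F : MvPolynomial (Fin (m + 1)) K) :
    rootHom K m (coeffF K m F) = rootF K m (rootHom K m F) := by
  refine map_derivation_eq _ _ _ (fun i => ?_) F
  rw [coeffF, mkDerivation_X]
  conv_rhs => rw [rootHom, aeval_X]
  rcases (i : ℕ) with _ | j
  · rw [rootF_rootCoeff_zero]
    exact map_zero _
  · rw [rootF_rootCoeff_succ, map_smul, rootHom_coeffVar]

/-- Once the leading coefficient is a non-zero constant, the other coefficients are non-zero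
multiples of the elementary symmetric polynomials, which are algebraically independent. So an
element of the kernel vanishes wherever its last variable does not. -/
lemma rootHom_injective [CharZero K] : Function.Injective (rootHom K m) := by
  rw [injective_iff_map_eq_zero]
  intro F hF
  have key : ∀ q : Fin (m + 1) → K, q (Fin.last m) ≠ 0 → eval q F = 0 := by
    intro q hc
    set c := q (Fin.last m) with hc_def
    -- `t j` stands for the elementary symmetric polynomial of degree `j`, with `t 0 = 1`; the
    -- default `0` is used only for `j > m`.
    let t : ℕ → MvPolynomial (Fin m) K := fun j =>
      Nat.casesOn j 1 fun k => if h : k < m then X ⟨k, h⟩ else 0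
    let g : Fin (m + 1) → MvPolynomial (Fin m) K := fun i =>
      C ((-1) ^ (m - (i : ℕ)) * c) * t (m - i)
    let ev : MvPolynomial (Option (Fin m)) K →ₐ[K] MvPolynomial (Fin m) K :=
      aeval fun o => o.elim (C c) X
    have h1 : (aeval fun j : Fin m => esymm (Fin m) K (j + 1)).comp (aeval g) =
        ev.comp (rootHom K m) := by
      refine algHom_ext fun i => ?_
      have hi : (i : ℕ) = m - (m - i) := by omega
      have h2 : ev (rename some (esymm (Fin m) K (m - i))) = esymm (Fin m) K (m - i) := by
        simp only [ev, aeval_rename]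
        exact aeval_X_left_apply _
      have h3 : aeval (fun j : Fin m => esymm (Fin m) K (j + 1)) (t (m - i)) =
          esymm (Fin m) K (m - i) := by
        have hle : m - (i : ℕ) ≤ m := Nat.sub_le _ _
        generalize m - (i : ℕ) = k at hle
        cases k with
        | zero => simp [t]
        | succ k => simp [t, show k < m by omega]
      have h4 : ev (X none) = C c := aeval_X ..
      simp only [AlgHom.comp_apply, aeval_X, g, map_mul, h3]
      rw [rootHom, aeval_X, hi, rootCoeff_sub K m (Nat.sub_le _ _), ← hi, map_mul, map_mul, h2, h4]
      simp
      ring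
    have h2 : aeval g F = 0 := by
      refine esymmAlgHom_injective (σ := Fin m) (n := m) (R := K) (by simp) ?_
      rw [map_zero]
      apply Subtype.ext
      rw [esymmAlgHom_apply]
      have := AlgHom.congr_fun h1 F
      rw [AlgHom.comp_apply, AlgHom.comp_apply, hF, map_zero] at this
      exact this
    -- Vieta's formulas solved for the elementary symmetric functions, so that `g` evaluates at `r`
    -- to `q`.
    let r : Fin m → K := fun j => q ⟨m - 1 - j, by omega⟩ / ((-1) ^ ((j : ℕ) + 1) * c)
    have h3 := congr_arg (eval r) h2
    rw [eval_aeval_eq, map_zero] at h3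
    convert h3 using 2
    congr 1
    funext i
    have hle : (i : ℕ) ≤ m := by omega
    obtain ⟨k, hk⟩ : ∃ k, m - (i : ℕ) = k := ⟨_, rfl⟩
    simp only [g, hk]
    cases k with
    | zero =>
      have : i = Fin.last m := Fin.ext (by simp; omega)
      simp [t, this, hc_def]
    | succ k =>
      have : (⟨m - 1 - k, by omega⟩ : Fin (m + 1)) = i := Fin.ext (by simp; omega)
      simp [t, show k < m by omega, r, this]
      field_simp
  have h : X (Fin.last m) * F = 0 := by
    refine MvPolynomial.funext fun q => ?_
    by_cases hq : q (Fin.last m) = 0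
    · simp [hq]
    · simp [key q hq]
  exact (mul_eq_zero.1 h).resolve_left (X_ne_zero _)

/-- An elementary symmetric polynomial is, up to sign, a coefficient divided by the leading one; the
power of `X none` clears these denominators. -/
lemma exists_rootHom_eq_of_isSymmetric {s : MvPolynomial (Fin m) K} (hs : s.IsSymmetric) :
    ∃ N G, X none ^ N * rename some s = rootHom K m G := by
  obtain ⟨P, hP⟩ := esymmAlgHom_surjective (σ := Fin m) (n := m) (R := K) (by simp) ⟨s, hs⟩
  have hP' : aeval (fun j : Fin m => esymm (Fin m) K (j + 1)) P = s := by
    rw [← esymmAlgHom_apply, hP]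
  rw [← hP']
  clear hP hP' hs
  induction P using MvPolynomial.induction_on with
  | C a => exact ⟨0, C a, by simp [rootHom]⟩
  | add P Q hP hQ =>
    obtain ⟨N, G, hG⟩ := hP
    obtain ⟨N', G', hG'⟩ := hQ
    refine ⟨N + N', coeffVar K m m ^ N' * G + coeffVar K m m ^ N * G', ?_⟩
    simp only [map_add, map_mul, map_pow, rootHom_coeffVar, rootCoeff_self, ← hG, ← hG']
    ring
  | mul_X P j hP =>
    obtain ⟨N, G, hG⟩ := hP
    refine ⟨N + 1, G * ((-1) ^ ((j : ℕ) + 1) * coeffVar K m (m - (j + 1))), ?_⟩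
    simp only [map_mul, map_pow, map_neg, map_one, rootHom_coeffVar, ← hG, aeval_X]
    rw [rootCoeff_sub K m (by omega)]
    have : ((-1) ^ ((j : ℕ) + 1) * (-1) ^ ((j : ℕ) + 1) : MvPolynomial (Option (Fin m)) K) = 1 := by
      rw [← mul_pow]; simp
    linear_combination (-(X none ^ N * rename some (aeval (fun j : Fin m =>
      esymm (Fin m) K (j + 1)) P) * X none * rename some (esymm (Fin m) K (j + 1)))) * this

/-- Invariance under `rootF` permits division by the leading coefficient. If `A ^ (N + 1) * c` is
`G` in the coefficients, applying `rootF` shows that `A` divides `(N + 1) * coeff_{m-1} * G`; being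
a prime variable different from `coeff_{m-1}`, it divides `G`. -/
lemma exists_rootHom_eq_of_rootF_eq_zero [CharZero K] (hm : 1 ≤ m)
    {c : MvPolynomial (Option (Fin m)) K} (hc : rootF K m c = 0) (N : ℕ)
    (h : ∃ G, X none ^ N * c = rootHom K m G) : ∃ G, c = rootHom K m G := by
  induction N with
  | zero => simpa using h
  | succ N ih =>
    obtain ⟨G, hG⟩ := h
    refine ih ?_
    obtain ⟨k, rfl⟩ : ∃ k, m = k + 1 := ⟨m - 1, by omega⟩
    have hA : rootF K (k + 1) (X none) = -rootCoeff K (k + 1) k := by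
      rw [← rootCoeff_self, rootF_rootCoeff_succ]
      simp
    have h1 : coeffVar K (k + 1) (k + 1) * coeffF K (k + 1) G =
        -(C ((N + 1 : ℕ) : K) * coeffVar K (k + 1) k * G) := by
      apply rootHom_injective K (k + 1)
      rw [map_mul, rootHom_coeffF, ← hG, Derivation.leibniz, hc, Derivation.leibniz_pow, hA,
        map_neg, map_mul, map_mul, ← hG, rootHom_coeffVar, rootHom_coeffVar, rootCoeff_self]
      simp
      ring
    have hv : coeffVar K (k + 1) (k + 1) = X (Fin.last (k + 1)) := coeffVar_val K (k + 1) (Fin.last _)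
    have hw : coeffVar K (k + 1) k = X ⟨k, by omega⟩ := dif_pos _
    rw [hv, hw] at h1
    have h2 : (X (Fin.last (k + 1)) : MvPolynomial (Fin (k + 1 + 1)) K) ∣ G := by
      have hp : Prime (X (Fin.last (k + 1)) : MvPolynomial (Fin (k + 1 + 1)) K) := by
        exact X_prime
      have h3 := (dvd_neg.1 (Dvd.intro _ h1))
      rcases hp.dvd_or_dvd h3 with h4 | h4
      · rcases hp.dvd_or_dvd h4 with h5 | h5
        · refine absurd (isUnit_of_dvd_unit h5 ?_) hp.not_isUnit
          exact (IsUnit.mk0 _ (Nat.cast_ne_zero.2 N.succ_ne_zero)).map C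
        · rw [X_dvd_X] at h5
          exact absurd (congr_arg Fin.val h5) (by simp)
      · exact h4
    obtain ⟨G', rfl⟩ := h2
    refine ⟨G', mul_left_cancel₀ (X_ne_zero (none : Option (Fin (k + 1)))) ?_⟩
    rw [← mul_assoc, ← pow_succ', hG, map_mul, ← hv, rootHom_coeffVar, rootCoeff_self]

end RootAlgHom

end CoadjointInvariants

/-! ### Invariants of binary forms from products of root differences -/

namespace CoadjointInvariants

open MvPolynomial Module

section GradAt

variable {K κ : Type*} [Field K]

lemma gradAt_mul_of_eigen {w : κ → K} {F G : MvPolynomial κ K} {l k : κ → K}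
    (hF : gradAt w F = eval w F • l) (hG : gradAt w G = eval w G • k) :
    gradAt w (F * G) = eval w (F * G) • (l + k) := by
  rw [gradAt_mul, hF, hG, map_mul]
  module

lemma gradAt_prod_of_eigen {w : κ → K} {β : Type*} (s : Finset β) (x : β → MvPolynomial κ K)
    (l : β → κ → K) (h : ∀ k ∈ s, gradAt w (x k) = eval w (x k) • l k) :
    gradAt w (∏ k ∈ s, x k) = eval w (∏ k ∈ s, x k) • ∑ k ∈ s, l k := by
  classical
  induction s using Finset.induction_on with
  | empty => ext; simp [gradAt]
  | insert k s hk ih =>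
    rw [Finset.prod_insert hk, Finset.sum_insert hk]
    exact gradAt_mul_of_eigen (h k (Finset.mem_insert_self _ _))
      (ih fun j hj => h j (Finset.mem_insert_of_mem hj))

lemma gradAt_pow_of_eigen {w : κ → K} {x : MvPolynomial κ K} {l : κ → K}
    (h : gradAt w x = eval w x • l) (n : ℕ) :
    gradAt w (x ^ n) = eval w (x ^ n) • ((n : K) • l) := by
  have := gradAt_prod_of_eigen (Finset.range n) (fun _ => x) (fun _ => l) fun _ _ => h
  simpa [← Nat.cast_smul_eq_nsmul K] using this

lemma gradAt_sum {β : Type*} (w : κ → K) (s : Finset β) (F : β → MvPolynomial κ K) :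
    gradAt w (∑ k ∈ s, F k) = ∑ k ∈ s, gradAt w (F k) := by
  ext; simp [gradAt]

lemma gradAt_pow (w : κ → K) (F : MvPolynomial κ K) (n : ℕ) :
    gradAt w (F ^ n) = (n * eval w F ^ (n - 1)) • gradAt w F := by
  ext
  simp [gradAt, Derivation.leibniz_pow]
  ring

/-- Pairing with `V` and reading off `N` coordinates together embed `κ → K` into `V* × K^N`. -/
lemma card_le_finrank_add [Fintype κ] (V : Submodule K (κ → K)) {N : ℕ} (i : Fin N → κ)
    (h : ∀ v, (∀ u ∈ V, v ⬝ᵥ u = 0) → (∀ k, v (i k) = 0) → v = 0) :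
    Fintype.card κ ≤ finrank K V + N := by
  classical
  let T : (κ → K) →ₗ[K] Dual K V × (Fin N → K) :=
    (V.subtype.dualMap ∘ₗ (dotProductEquiv K κ).toLinearMap).prod (LinearMap.funLeft K K i)
  have hT : Function.Injective T := by
    rw [injective_iff_map_eq_zero]
    intro v hv
    obtain ⟨h1, h2⟩ := Prod.ext_iff.1 hv
    refine h v (fun u hu => ?_) fun k => congr_fun h2 k
    have h3 : (T v).1 ⟨u, hu⟩ = 0 := by rw [h1]; rfl
    exact h3
  simpa using LinearMap.finrank_le_finrank_of_injective hT

/-- The derivative of a power sum is `r ∑ y ^ (r - 1) dy`. The values of the `y` at `w` are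
distinct, so a Vandermonde matrix recovers the individual `dy`: symmetrising by power sums loses no
differentials. -/
lemma dotProduct_gradAt_eq_zero [Fintype κ] [CharZero K] {w v : κ → K}
    (Y : Finset (MvPolynomial κ K)) (hY : Set.InjOn (eval w) (Y : Set (MvPolynomial κ K)))
    (h : ∀ r, v ⬝ᵥ gradAt w (∑ y ∈ Y, y ^ r) = 0) {y : MvPolynomial κ K} (hy : y ∈ Y) :
    v ⬝ᵥ gradAt w y = 0 := by
  let e := Y.equivFin
  have h0 : (fun j => v ⬝ᵥ gradAt w (e.symm j : MvPolynomial κ K)) = 0 := by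
    refine Matrix.eq_zero_of_forall_pow_sum_mul_pow_eq_zero
      (f := fun j => eval w (e.symm j : MvPolynomial κ K)) ?_ ?_
    · intro j k hjk
      exact e.symm.injective (Subtype.ext (hY (e.symm j).2 (e.symm k).2 hjk))
    · intro r
      -- The shift makes the exponent `r` and the factor `r + 1`, which is invertible.
      have hr := h (r + 1)
      simp only [gradAt_sum, gradAt_pow, dotProduct_sum, dotProduct_smul, Nat.add_sub_cancel,
        smul_eq_mul, mul_assoc, ← Finset.mul_sum] at hr
      have hr' := (mul_eq_zero.1 hr).resolve_left (Nat.cast_ne_zero.2 (Nat.succ_ne_zero _))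
      rw [← hr', ← Finset.sum_coe_sort Y, ← e.symm.sum_comp]
      exact Finset.sum_congr rfl fun j _ => mul_comm _ _
  have h1 := congr_fun h0 (e ⟨y, hy⟩)
  simpa using h1

end GradAt

section RootMonomial

variable (K : Type*) [Field K] (m : ℕ)

/-- A product of differences of roots. -/
noncomputable def rootMonomial (n : Fin m → Fin m → ℕ) : MvPolynomial (Fin m) K :=
  ∏ i, ∏ j, (X i - X j) ^ n i j

/-- The homogenized version of a polynomial in the roots. -/
noncomputable def rootHomogenize (q : MvPolynomial (Fin m) K) :
    MvPolynomial (Option (Fin m)) K :=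
  X none ^ (2 * (m - 1)) * rename some q

/-- The exponents that are at most two and in which each root occurs `2 * (m - 1)` times. -/
def rootExponents : Finset (Fin m → Fin m → ℕ) :=
  (Fintype.piFinset fun _ => Fintype.piFinset fun _ => Finset.range 3).filter fun n =>
    (∀ i, n i i = 0) ∧ ∀ i, ∑ j, n i j + ∑ j, n j i = 2 * (m - 1)

variable {m}

lemma mem_rootExponents {n : Fin m → Fin m → ℕ} : n ∈ rootExponents m ↔
    (∀ i j, n i j < 3) ∧ (∀ i, n i i = 0) ∧ ∀ i, ∑ j, n i j + ∑ j, n j i = 2 * (m - 1) := by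
  simp [rootExponents]

lemma rootHomogenize_rootMonomial (n : Fin m → Fin m → ℕ) :
    rootHomogenize K m (rootMonomial K m n) = X none ^ (2 * (m - 1)) *
      ∏ i, ∏ j, (X (some i) - X (some j)) ^ n i j := by
  simp [rootHomogenize, rootMonomial]

lemma derivation_rootMonomial
    (D : Derivation K (MvPolynomial (Option (Fin m)) K) (MvPolynomial (Option (Fin m)) K))
    {l₀ : MvPolynomial (Option (Fin m)) K} {l : Fin m → Fin m → MvPolynomial (Option (Fin m)) K}
    (h₀ : D (X none) = l₀ * X none)
    (h : ∀ i j, D (X (some i) - X (some j)) = l i j * (X (some i) - X (some j)))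
    (n : Fin m → Fin m → ℕ) : D (rootHomogenize K m (rootMonomial K m n)) =
      ((2 * (m - 1) : ℕ) * l₀ + ∑ i, ∑ j, n i j * l i j) *
        rootHomogenize K m (rootMonomial K m n) := by
  rw [rootHomogenize_rootMonomial]
  exact derivation_mul_of_eigen D (derivation_pow_of_eigen D h₀ _)
    (derivation_prod_of_eigen D _ _ _ fun i _ =>
      derivation_prod_of_eigen D _ _ _ fun j _ => derivation_pow_of_eigen D (h i j) _)

lemma rootE_rootMonomial (n : Fin m → Fin m → ℕ) :
    rootE K m (rootHomogenize K m (rootMonomial K m n)) = 0 := by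
  rw [derivation_rootMonomial K (rootE K m) (l₀ := 0) (l := fun _ _ => 0)] <;> simp

lemma rootH_rootMonomial {n : Fin m → Fin m → ℕ} (hn : n ∈ rootExponents m) :
    rootH K m (rootHomogenize K m (rootMonomial K m n)) = 0 := by
  rw [derivation_rootMonomial K (rootH K m) (l₀ := -(m : MvPolynomial (Option (Fin m)) K))
    (l := fun _ _ => 2) (by simp) (fun i j => by simp; ring)]
  -- Counting root occurrences counts every difference twice; this weight balances that of `A ^ (2 *
  -- (m - 1))`.
  have h1 : ∑ i, (∑ j, n i j + ∑ j, n j i) = m * (2 * (m - 1)) := by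
    simp [(mem_rootExponents.1 hn).2.2]
  rw [Finset.sum_add_distrib, Finset.sum_comm (f := fun i j => n j i)] at h1
  have h2 := congr_arg (Nat.cast : ℕ → MvPolynomial (Option (Fin m)) K) h1
  simp only [← Finset.sum_mul]
  refine mul_eq_zero_of_left ?_ _
  rw [Nat.cast_add, Nat.cast_mul] at h2
  push_cast at h2 ⊢
  linear_combination h2

lemma rootF_rootMonomial {n : Fin m → Fin m → ℕ} (hn : n ∈ rootExponents m) :
    rootF K m (rootHomogenize K m (rootMonomial K m n)) = 0 := by
  rw [derivation_rootMonomial K (rootF K m) (l₀ := ∑ j, X (some j))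
    (l := fun i j => -(X (some i) + X (some j))) (by simp) (fun i j => by simp; ring)]
  refine mul_eq_zero_of_left ?_ _
  have h1 : ∀ i : Fin m, ((2 * (m - 1) : ℕ) : MvPolynomial (Option (Fin m)) K) * X (some i) =
      ∑ j, (n i j : MvPolynomial (Option (Fin m)) K) * X (some i) +
      ∑ j, (n j i : MvPolynomial (Option (Fin m)) K) * X (some i) := fun i => by
    rw [← (mem_rootExponents.1 hn).2.2 i, ← Finset.sum_mul, ← Finset.sum_mul, ← add_mul]
    push_cast
    rfl
  rw [Finset.mul_sum, Finset.sum_congr rfl fun i _ => h1 i, Finset.sum_add_distrib]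
  conv_lhs => enter [1, 2]; rw [Finset.sum_comm]
  simp only [mul_neg, mul_add, Finset.sum_neg_distrib, Finset.sum_add_distrib]
  ring

lemma rename_rootMonomial (σ : Equiv.Perm (Fin m)) (n : Fin m → Fin m → ℕ) :
    rename σ (rootMonomial K m n) = rootMonomial K m fun i j => n (σ.symm i) (σ.symm j) := by
  simp only [rootMonomial, map_prod, map_pow, map_sub, rename_X]
  rw [← Equiv.prod_comp σ fun i => ∏ j, (X i - X j : MvPolynomial (Fin m) K) ^ n (σ.symm i) (σ.symm j)]
  refine Finset.prod_congr rfl fun i _ => ?_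
  rw [← Equiv.prod_comp σ fun j => (X (σ i) - X j : MvPolynomial (Fin m) K) ^
    n (σ.symm (σ i)) (σ.symm j)]
  simp

lemma comp_mem_rootExponents (σ : Equiv.Perm (Fin m)) {n : Fin m → Fin m → ℕ}
    (hn : n ∈ rootExponents m) : (fun i j => n (σ i) (σ j)) ∈ rootExponents m := by
  rw [mem_rootExponents] at hn ⊢
  refine ⟨fun i j => hn.1 _ _, fun i => hn.2.1 _, fun i => ?_⟩
  rw [Equiv.sum_comp σ fun j => n (σ i) j, Equiv.sum_comp σ fun j => n j (σ i)]
  exact hn.2.2 _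

open scoped Classical in
/-- The products of differences of roots with exponents in `rootExponents`. -/
noncomputable def rootMonomials : Finset (MvPolynomial (Fin m) K) :=
  (rootExponents m).image (rootMonomial K m)

lemma mem_rootMonomials {q : MvPolynomial (Fin m) K} :
    q ∈ rootMonomials K ↔ ∃ n ∈ rootExponents m, rootMonomial K m n = q := by
  classical
  simp [rootMonomials]

lemma rename_mem_rootMonomials (σ : Equiv.Perm (Fin m)) {q : MvPolynomial (Fin m) K}
    (hq : q ∈ rootMonomials K) : rename σ q ∈ rootMonomials K := by
  rw [mem_rootMonomials] at hq ⊢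
  obtain ⟨n, hn, rfl⟩ := hq
  exact ⟨_, comp_mem_rootExponents σ.symm hn, (rename_rootMonomial K σ n).symm⟩

lemma isSymmetric_sum_rootMonomials (r : ℕ) :
    (∑ q ∈ rootMonomials (m := m) K, q ^ r).IsSymmetric := by
  intro σ
  rw [map_sum]
  refine Finset.sum_bij' (fun q _ => rename σ q) (fun q _ => rename σ.symm q)
    (fun q hq => rename_mem_rootMonomials K σ hq)
    (fun q hq => rename_mem_rootMonomials K σ.symm hq) ?_ ?_ ?_
  · intro q _; simp [rename_rename]
  · intro q _; simp [rename_rename]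
  · intro q _; simp

lemma rootHomogenize_injective : Function.Injective (rootHomogenize K m) := fun _ _ h =>
  rename_injective _ (Option.some_injective _)
    (mul_left_cancel₀ (pow_ne_zero _ (X_ne_zero _)) h)

open scoped Classical in
/-- The homogenized products of differences of roots. -/
noncomputable def rootForms : Finset (MvPolynomial (Option (Fin m)) K) :=
  (rootMonomials K).image (rootHomogenize K m)

lemma mem_rootForms {y : MvPolynomial (Option (Fin m)) K} : y ∈ rootForms K ↔
    ∃ n ∈ rootExponents m, rootHomogenize K m (rootMonomial K m n) = y := by
  classical
  simp [rootForms, rootMonomials]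

variable (m) in
/-- The polynomials in the coefficients that are killed by the action of `sl 2`. -/
def coeffInvariants : Set (MvPolynomial (Fin (m + 1)) K) :=
  {F | coeffE K m F = 0 ∧ coeffH K m F = 0 ∧ coeffF K m F = 0}

/-- The power sum is killed by all three root derivations. Symmetry makes it polynomial in the
coefficients up to a power of `A`, invariance under `rootF` removes that power, and injectivity of
`rootHom` transports the equations. -/
lemma exists_coeffInvariant [CharZero K] (hm : 1 ≤ m) (r : ℕ) :
    ∃ F ∈ coeffInvariants K m, rootHom K m F = ∑ y ∈ rootForms K, y ^ r := by
  classical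
  have kill : ∀ D : Derivation K (MvPolynomial (Option (Fin m)) K)
      (MvPolynomial (Option (Fin m)) K),
      (∀ n ∈ rootExponents m, D (rootHomogenize K m (rootMonomial K m n)) = 0) →
      D (∑ y ∈ rootForms K, y ^ r) = 0 := by
    intro D hD
    rw [map_sum]
    refine Finset.sum_eq_zero fun y hy => ?_
    obtain ⟨n, hn, rfl⟩ := (mem_rootForms K).1 hy
    rw [Derivation.leibniz_pow, hD n hn, smul_zero, smul_zero]
  have hE := kill (rootE K m) fun n _ => rootE_rootMonomial K n
  have hH := kill (rootH K m) fun n hn => rootH_rootMonomial K hn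
  have hF := kill (rootF K m) fun n hn => rootF_rootMonomial K hn
  obtain ⟨N, G, hG⟩ := exists_rootHom_eq_of_isSymmetric K m (isSymmetric_sum_rootMonomials K r)
  have hsum : ∑ y ∈ rootForms (m := m) K, y ^ r = X none ^ (2 * (m - 1) * r) *
      rename some (∑ q ∈ rootMonomials (m := m) K, q ^ r) := by
    rw [rootForms, Finset.sum_image fun _ _ _ _ h => rootHomogenize_injective K h, map_sum,
      Finset.mul_sum]
    refine Finset.sum_congr rfl fun q _ => ?_
    simp only [rootHomogenize, mul_pow, map_pow, ← pow_mul]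
  obtain ⟨F, hFG⟩ := exists_rootHom_eq_of_rootF_eq_zero K m hm hF N
    ⟨coeffVar K m m ^ (2 * (m - 1) * r) * G, by
      rw [hsum, map_mul, map_pow, rootHom_coeffVar, rootCoeff_self, ← hG]
      ring⟩
  refine ⟨F, ⟨?_, ?_, ?_⟩, hFG.symm⟩ <;> apply rootHom_injective K m
  · rw [rootHom_coeffE, ← hFG, hE, map_zero]
  · rw [rootHom_coeffH, ← hFG, hH, map_zero]
  · rw [rootHom_coeffF, ← hFG, hF, map_zero]

end RootMonomial

end CoadjointInvariants

/-! ### Rank of the gradients at a generic configuration of roots -/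

namespace CoadjointInvariants

open MvPolynomial Module

section RootPoint

variable (K : Type*) [Field K] {m : ℕ}

/-- A generic point avoids finitely many hypersurfaces. Distinct exponents may give the same
product, but `rootForms` is a set of polynomials, so its members can be separated. -/
lemma exists_root_point (m : ℕ) [CharZero K] : ∃ w : Option (Fin m) → K, w none ≠ 0 ∧
    Function.Injective (fun i => w (some i)) ∧
    Set.InjOn (eval w) (rootForms (m := m) K : Set (MvPolynomial (Option (Fin m)) K)) := by
  classical
  have h1 : (X none : MvPolynomial (Option (Fin m)) K) ≠ 0 := X_ne_zero _
  have h2 : (∏ i : Fin m, ∏ j ∈ Finset.univ.erase i,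
      (X (some i) - X (some j) : MvPolynomial (Option (Fin m)) K)) ≠ 0 := by
    refine Finset.prod_ne_zero_iff.2 fun i _ => Finset.prod_ne_zero_iff.2 fun j hj => ?_
    rw [sub_ne_zero]
    intro h
    have := X_injective h
    exact (Finset.ne_of_mem_erase hj) (Option.some_injective _ this).symm
  have h3 : (∏ y ∈ rootForms (m := m) K, ∏ z ∈ (rootForms K).erase y, (y - z)) ≠ 0 :=
    Finset.prod_ne_zero_iff.2 fun y _ => Finset.prod_ne_zero_iff.2 fun z hz =>
      sub_ne_zero.2 (Finset.ne_of_mem_erase hz).symm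
  obtain ⟨w, hw⟩ := exists_eval_ne_zero (mul_ne_zero (mul_ne_zero h1 h2) h3)
  simp only [map_mul, map_prod, map_sub, eval_X, mul_ne_zero_iff, Finset.prod_ne_zero_iff] at hw
  refine ⟨w, hw.1.1, fun i j hij => ?_, fun y hy z hz hyz => ?_⟩
  · by_contra hne
    exact hw.1.2 i (Finset.mem_univ _) j (Finset.mem_erase.2 ⟨Ne.symm hne, Finset.mem_univ _⟩)
      (sub_eq_zero.2 hij)
  · by_contra hne
    exact hw.2 y hy z (Finset.mem_erase.2 ⟨Ne.symm hne, hz⟩) (sub_eq_zero.2 hyz)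

variable {K}

/-- Logarithmic differentiation in the direction `v`. In the terms with `i = j` the convention `0⁻¹
= 0` is harmless, since the difference of `v` is zero as well. -/
lemma dotProduct_gradAt_rootMonomial {w : Option (Fin m) → K} (h₀ : w none ≠ 0)
    (hw : Function.Injective fun i => w (some i)) (v : Option (Fin m) → K)
    (n : Fin m → Fin m → ℕ) :
    v ⬝ᵥ gradAt w (rootHomogenize K m (rootMonomial K m n)) =
      eval w (rootHomogenize K m (rootMonomial K m n)) *
        ((2 * (m - 1) : ℕ) * ((w none)⁻¹ * v none) + ∑ i, ∑ j, n i j *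
          ((w (some i) - w (some j))⁻¹ * (v (some i) - v (some j)))) := by
  classical
  have h1 : gradAt w (X none) =
      eval w (X none) • ((w none)⁻¹ • Pi.single none 1 : Option (Fin m) → K) := by
    rw [eval_X, smul_smul, mul_inv_cancel₀ h₀, one_smul]
    ext o
    simp only [gradAt, pderiv_X, Pi.single_apply, apply_ite (eval w), map_one, map_zero]
    exact if_congr eq_comm rfl rfl
  have h2 : ∀ i j, gradAt w (X (some i) - X (some j)) = eval w (X (some i) - X (some j)) •
      ((w (some i) - w (some j))⁻¹ • (Pi.single (some i) 1 - Pi.single (some j) 1) :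
        Option (Fin m) → K) := fun i j => by
    by_cases hij : i = j
    · subst hij
      ext; simp [gradAt]
    · have : w (some i) - w (some j) ≠ 0 := sub_ne_zero.2 fun h => hij (hw h)
      rw [map_sub, eval_X, eval_X, smul_smul, mul_inv_cancel₀ this, one_smul]
      ext o
      simp only [gradAt, map_sub, pderiv_X, Pi.single_apply, apply_ite (eval w), map_one, map_zero,
        Pi.sub_apply]
      congr 1 <;> exact if_congr eq_comm rfl rfl
  rw [rootHomogenize_rootMonomial, gradAt_mul_of_eigen (gradAt_pow_of_eigen h1 _)
    (gradAt_prod_of_eigen _ _ _ fun i _ => gradAt_prod_of_eigen _ _ _ fun j _ =>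
      gradAt_pow_of_eigen (h2 i j) _)]
  simp [dotProduct_smul, dotProduct_add, dotProduct_sum, dotProduct_sub, mul_add]

lemma eval_rootMonomial_ne_zero {w : Option (Fin m) → K} (h₀ : w none ≠ 0)
    (hw : Function.Injective fun i => w (some i)) {n : Fin m → Fin m → ℕ} (hn : ∀ i, n i i = 0) :
    eval w (rootHomogenize K m (rootMonomial K m n)) ≠ 0 := by
  simp only [rootHomogenize_rootMonomial, map_mul, map_pow, map_prod, map_sub, eval_X]
  refine mul_ne_zero (pow_ne_zero _ h₀)
    (Finset.prod_ne_zero_iff.2 fun i _ => Finset.prod_ne_zero_iff.2 fun j _ => ?_)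
  by_cases hij : i = j
  · simp [hij, hn]
  · exact pow_ne_zero _ (sub_ne_zero.2 fun h => hij (hw h))

/-- The exponents of the square of the Vandermonde determinant. -/
def vandermondeExponent (i j : Fin m) : ℕ := if i = j then 0 else 1

/-- The exponents of a single difference of roots. -/
def singleExponent (a b i j : Fin m) : ℕ := if i = a ∧ j = b then 1 else 0

/-- The exponents of the square of the Vandermonde determinant, multiplied by a cross-ratio. -/
def crossExponent (a b c t i j : Fin m) : ℕ :=
  vandermondeExponent i j + singleExponent a t i j + singleExponent b c i j -
    (singleExponent a b i j + singleExponent c t i j)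

lemma sum_vandermondeExponent (i : Fin m) : ∑ j, vandermondeExponent i j = m - 1 := by
  have h : ∑ j, (vandermondeExponent i j + if i = j then 1 else 0) = m := by
    rw [Finset.sum_congr rfl fun j _ => show
      vandermondeExponent i j + (if i = j then 1 else 0) = 1 by
        unfold vandermondeExponent; split_ifs <;> rfl]
    simp
  rw [Finset.sum_add_distrib] at h
  simp only [Finset.sum_ite_eq, Finset.mem_univ, if_true] at h
  omega

lemma vandermondeExponent_comm (i j : Fin m) :
    vandermondeExponent i j = vandermondeExponent j i := if_congr eq_comm rfl rfl

/-- The truncated subtraction in `crossExponent` is exact: the positions `(a, b)` and `(c, t)` are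
distinct and off the diagonal, where the Vandermonde exponent is `1`. -/
lemma crossExponent_add {a b c t : Fin m} (hab : a ≠ b) (hac : a ≠ c) (hct : c ≠ t)
    (i j : Fin m) :
    crossExponent a b c t i j + (singleExponent a b i j + singleExponent c t i j) =
      vandermondeExponent i j + singleExponent a t i j + singleExponent b c i j := by
  refine Nat.sub_add_cancel ?_
  unfold vandermondeExponent singleExponent
  split_ifs <;> grind

lemma sum_singleExponent (a b i : Fin m) :
    ∑ j, singleExponent a b i j = if i = a then 1 else 0 := by
  simp [singleExponent, ite_and]

lemma sum_singleExponent_swap (a b i : Fin m) :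
    ∑ j, singleExponent a b j i = if i = b then 1 else 0 := by
  simp [singleExponent, ite_and]

lemma vandermondeExponent_mem : (vandermondeExponent : Fin m → Fin m → ℕ) ∈ rootExponents m := by
  refine mem_rootExponents.2 ⟨fun i j => ?_, fun i => if_pos rfl, fun i => ?_⟩
  · unfold vandermondeExponent; split_ifs <;> omega
  · rw [Finset.sum_congr rfl fun j _ => vandermondeExponent_comm j i, sum_vandermondeExponent]
    omega

/-- The cross-ratio uses each of its four roots once above and once below, so the occurrence counts
stay at `2 * (m - 1)`; no exponent exceeds `2`. -/
lemma crossExponent_mem {a b c t : Fin m} (hab : a ≠ b) (hac : a ≠ c) (hbc : b ≠ c) (hat : a ≠ t)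
    (hct : c ≠ t) : crossExponent a b c t ∈ rootExponents m := by
  have key := crossExponent_add hab hac hct
  refine mem_rootExponents.2 ⟨fun i j => ?_, fun i => ?_, fun i => ?_⟩
  · have := key i j
    unfold vandermondeExponent singleExponent at this
    split_ifs at this <;> grind
  · have := key i i
    unfold vandermondeExponent singleExponent at this
    split_ifs at this <;> grind
  · have h1 := Finset.sum_congr (s₁ := Finset.univ) rfl fun j _ => key i j
    have h2 := Finset.sum_congr (s₁ := Finset.univ) rfl fun j _ => key j i
    have h3 := sum_vandermondeExponent i
    have h4 : ∑ j, vandermondeExponent j i = m - 1 := by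
      rw [Finset.sum_congr rfl fun j _ => vandermondeExponent_comm j i, h3]
    simp only [Finset.sum_add_distrib, sum_singleExponent, sum_singleExponent_swap, h3, h4] at h1 h2
    omega

/-- Comparing a cross exponent with the Vandermonde one, `v` annihilates the logarithmic
differential of every cross-ratio of `a, b, c, t`. A root is determined by its cross-ratio with
three fixed ones, so no root moves; the discriminant then controls the leading coefficient. -/
lemma eq_zero_of_dotProduct_gradAt_rootForms [CharZero K] {w : Option (Fin m) → K}
    (h₀ : w none ≠ 0) (hw : Function.Injective fun i => w (some i)) {v : Option (Fin m) → K}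
    (h : ∀ y ∈ rootForms K, v ⬝ᵥ gradAt w y = 0) {a b c : Fin m} (hab : a ≠ b) (hac : a ≠ c)
    (hbc : b ≠ c) (ha : v (some a) = 0) (hb : v (some b) = 0) (hc : v (some c) = 0) : v = 0 := by
  have key : ∀ n ∈ rootExponents m, (2 * (m - 1) : ℕ) * ((w none)⁻¹ * v none) +
      ∑ i, ∑ j, n i j * ((w (some i) - w (some j))⁻¹ * (v (some i) - v (some j))) = 0 := by
    intro n hn
    have h1 := h _ ((mem_rootForms K).2 ⟨n, hn, rfl⟩)
    rw [dotProduct_gradAt_rootMonomial h₀ hw] at h1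
    exact (mul_eq_zero.1 h1).resolve_left
      (eval_rootMonomial_ne_zero h₀ hw (mem_rootExponents.1 hn).2.1)
  have hsingle : ∀ (a b : Fin m) (f : Fin m → Fin m → K),
      ∑ i, ∑ j, (singleExponent a b i j : K) * f i j = f a b := fun a b f => by
    simp [singleExponent, ite_and]
  have hv : ∀ t, v (some t) = 0 := by
    intro t
    by_cases hat : a = t
    · rw [← hat, ha]
    by_cases hct : c = t
    · rw [← hct, hc]
    have h1 := key _ vandermondeExponent_mem
    have h2 := key _ (crossExponent_mem hab hac hbc hat hct)
    set f : Fin m → Fin m → K := fun i j =>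
      (w (some i) - w (some j))⁻¹ * (v (some i) - v (some j)) with hf
    change _ + ∑ i, ∑ j, _ * f i j = 0 at h1
    change _ + ∑ i, ∑ j, _ * f i j = 0 at h2
    have h3 : ∑ i, ∑ j, ((crossExponent a b c t i j + (singleExponent a b i j +
        singleExponent c t i j) : ℕ) : K) * f i j = ∑ i, ∑ j, ((vandermondeExponent i j +
          singleExponent a t i j + singleExponent b c i j : ℕ) : K) * f i j := by
      simp only [crossExponent_add hab hac hct]
    simp only [Nat.cast_add, add_mul, Finset.sum_add_distrib, hsingle] at h3
    have h4 : f a b + f c t = f a t + f b c := by linear_combination h3 - h2 + h1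
    have hat' : w (some a) - w (some t) ≠ 0 := sub_ne_zero.2 fun h => hat (hw h)
    have hct' : w (some c) - w (some t) ≠ 0 := sub_ne_zero.2 fun h => hct (hw h)
    have hac' : w (some a) - w (some c) ≠ 0 := sub_ne_zero.2 fun h => hac (hw h)
    simp only [hf, ha, hb, hc, sub_self, zero_sub, mul_zero, zero_add, add_zero] at h4
    field_simp at h4
    have h5 : (w (some a) - w (some c)) * v (some t) = 0 := by linear_combination -h4
    exact (mul_eq_zero.1 h5).resolve_left hac'
  funext o
  cases o with
  | some t => exact hv t
  | none =>
    have h1 := key _ vandermondeExponent_mem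
    simp only [hv, sub_self, mul_zero, Finset.sum_const_zero, add_zero] at h1
    have hm : ((2 * (m - 1) : ℕ) : K) ≠ 0 := by
      have : a.1 ≠ b.1 := fun h => hab (Fin.ext h)
      exact Nat.cast_ne_zero.2 (by omega)
    simpa [h₀] using (mul_eq_zero.1 h1).resolve_left hm

/-- The root space has dimension `m + 1`, and three fixed roots account for the directions left
undetected. The linear map `T` from gradients in the coefficients to gradients in the roots cannot
raise the rank, so the bound passes to the coefficients. -/
theorem exists_le_finrank_coeffInvariants [CharZero K] (hm : 3 ≤ m) : ∃ q : Fin (m + 1) → K,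
    m - 2 ≤ finrank K (Submodule.span K (gradAt q '' coeffInvariants K m)) := by
  obtain ⟨w, h₀, hw, hY⟩ := exists_root_point K m
  let q : Fin (m + 1) → K := fun i => eval w (rootCoeff K m i)
  let T : (Fin (m + 1) → K) →ₗ[K] (Option (Fin m) → K) :=
    Fintype.linearCombination K fun i => gradAt w (rootCoeff K m i)
  have hT : ∀ F, gradAt w (rootHom K m F) = T (gradAt q F) := fun F => by
    rw [rootHom, gradAt_aeval, Fintype.linearCombination_apply]
  refine ⟨q, ?_⟩
  set V := Submodule.span K (gradAt q '' coeffInvariants K m)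
  have h1 : Fintype.card (Option (Fin m)) ≤ finrank K (V.map T) + 3 := by
    let i0 : Fin m := ⟨0, by omega⟩
    let i1 : Fin m := ⟨1, by omega⟩
    let i2 : Fin m := ⟨2, by omega⟩
    refine card_le_finrank_add (V.map T) ![some i0, some i1, some i2] fun v hv hi => ?_
    refine eq_zero_of_dotProduct_gradAt_rootForms h₀ hw (a := i0) (b := i1) (c := i2) ?_
      (by simp [i0, i1]) (by simp [i0, i2]) (by simp [i1, i2]) (hi 0) (hi 1) (hi 2)
    intro y hy
    refine dotProduct_gradAt_eq_zero (rootForms K) hY (fun r => ?_) hy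
    obtain ⟨F, hF, hFr⟩ := exists_coeffInvariant K (by omega : 1 ≤ m) r
    rw [← hFr, hT]
    exact hv _ (Submodule.mem_map_of_mem (Submodule.subset_span ⟨F, hF, rfl⟩))
  have h2 := Submodule.finrank_map_le T V
  rw [Fintype.card_option, Fintype.card_fin] at h1
  omega

end RootPoint

/-! ### Invariants of binary forms as invariants of `L` -/

namespace StandardFrame

variable {ι K L : Type*} [Fintype ι] [Field K] [CharZero K] [LieRing L] [LieAlgebra K L] {m : ℕ}

/-- The inclusion of the polynomials in the basis vectors `a i` into the symmetric algebra. -/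
noncomputable def coeffHom (S : StandardFrame K L m) (b : Basis ι K L) :
    MvPolynomial (Fin (m + 1)) K →ₐ[K] MvPolynomial ι K :=
  aeval fun i => linForm b (S.a i)

omit [CharZero K] in
lemma coordA_a_val (S : StandardFrame K L m) (i j : Fin (m + 1)) :
    S.coordA i (S.a j) = if j = i then 1 else 0 := by
  rw [S.coordA_a i (by omega)]
  simp [Fin.val_inj, Nat.lt_succ_iff.1 i.2]

omit [CharZero K] in
lemma coeffHom_coeffVar (S : StandardFrame K L m) (b : Basis ι K L) {i : ℕ} (hi : i ≤ m + 1) :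
    S.coeffHom b (coeffVar K m i) = linForm b (S.a i) := by
  rw [coeffVar]
  split_ifs with h
  · exact aeval_X ..
  · rw [show i = m + 1 by omega, S.a_last, map_zero, map_zero]

-- On the `a i`, the elements `e`, `h`, `f` act as `coeffF`, `coeffH`, `coeffE`, in this order; the
-- `a i` act by zero because they commute.
omit [CharZero K] in
lemma coeffHom_mem_polyInvariants (S : StandardFrame K L m) (b : Basis ι K L)
    {F : MvPolynomial (Fin (m + 1)) K} (hF : F ∈ coeffInvariants K m) :
    S.coeffHom b F ∈ polyInvariants b := by
  obtain ⟨hE, hH, hF⟩ := hF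
  refine S.mem_polyInvariants b ?_ ?_ ?_ ?_
  · rw [← map_derivation_eq (S.coeffHom b) (coeffF K m), hF, map_zero]
    rintro ⟨i, hi⟩
    rw [coeffF, mkDerivation_X, coeffHom, aeval_X, lieDer_linForm]
    cases i with
    | zero => rw [S.lie_e_a_zero, map_zero]; exact map_zero _
    | succ i =>
      rw [S.lie_e_a_succ, map_smul]
      exact (congr_arg _ (S.coeffHom_coeffVar b (i := i) (by omega))).trans (map_smul _ _ _).symm
  · rw [← map_derivation_eq (S.coeffHom b) (coeffH K m), hH, map_zero]
    rintro ⟨i, hi⟩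
    rw [coeffH, mkDerivation_X, map_smul, S.coeffHom_coeffVar b (i := i) (by omega), coeffHom,
      aeval_X, lieDer_linForm, S.lie_h_a, map_smul]
  · rw [← map_derivation_eq (S.coeffHom b) (coeffE K m), hE, map_zero]
    rintro ⟨i, hi⟩
    rw [coeffE, mkDerivation_X, map_smul, S.coeffHom_coeffVar b (i := i + 1) (by omega), coeffHom,
      aeval_X, lieDer_linForm, S.lie_f_a, map_smul]
  · intro i hi
    rw [← map_derivation_eq (S.coeffHom b) 0]
    · simp
    · intro j
      rw [coeffHom, aeval_X, lieDer_linForm, S.lie_a_a]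
      simp

theorem exists_le_finrank_of_three_le (S : StandardFrame K L m) (hm : 3 ≤ m) (b : Basis ι K L) :
    ∃ p, m - 2 ≤ finrank K (Submodule.span K (gradAt p '' polyInvariants b)) := by
  obtain ⟨q, hq⟩ := exists_le_finrank_coeffInvariants (K := K) hm
  -- The functional with values `q` on the `a i` and zero on `e`, `h`, `f`; the gradients at `q`
  -- embed injectively into those at `p`.
  let p : ι → K := toPoint b (∑ i : Fin (m + 1), q i • S.coordA i)
  have hp : (fun i : Fin (m + 1) => eval p (linForm b (S.a i))) = q := by
    funext j
    rw [eval_linForm]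
    simp [coordA_a_val]
  let T : (Fin (m + 1) → K) →ₗ[K] (ι → K) :=
    Fintype.linearCombination K fun i : Fin (m + 1) => b.equivFun (S.a i)
  have hT : Function.Injective T := by
    rw [injective_iff_map_eq_zero]
    intro u hu
    have h1 : ∑ i : Fin (m + 1), u i • S.a i = 0 := by
      apply b.equivFun.injective
      rw [map_zero, map_sum, ← hu, Fintype.linearCombination_apply]
      simp only [map_smul]
    funext k
    have h2 := congr_arg (S.coordA k) h1
    simpa [coordA_a_val] using h2
  refine ⟨p, hq.trans ?_⟩
  rw [(Submodule.equivMapOfInjective T hT _).finrank_eq, Submodule.map_span]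
  refine Submodule.finrank_mono (Submodule.span_mono ?_)
  rintro _ ⟨_, ⟨F, hF, rfl⟩, rfl⟩
  refine ⟨S.coeffHom b F, S.coeffHom_mem_polyInvariants b hF, ?_⟩
  rw [coeffHom, gradAt_aeval, hp]
  simp only [T, Fintype.linearCombination_apply, gradAt_linForm]

end StandardFrame

end CoadjointInvariants

/-! ### The count in each dimension, with `m = d - 1` -/

theorem mainTheorem3 :
    (∀ (K R ι : Type*) [Field K] [CharZero K] [LieRing R] [LieAlgebra K R] [Module.Finite K R]
        [LieAlgebra.IsSolvable R] [Fintype ι]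
        (π : LieAlgebra.SpecialLinear.sl (Fin 2) K →ₗ⁅K⁆ LieDerivation K R R)
        (b : Module.Basis ι K
          (LieAlgebra.SemiDirectSum R (LieAlgebra.SpecialLinear.sl (Fin 2) K) π)) (d : ℕ),
        CoadjointInvariants.IsIrreducibleRep π → Module.finrank K R = d →
          (d = 1 → CoadjointInvariants.PolyNumberIs b 2) ∧
          (d = 2 → CoadjointInvariants.PolyNumberIs b 1) ∧
          (d = 3 → CoadjointInvariants.PolyNumberIs b 2) ∧
          (4 ≤ d → CoadjointInvariants.PolyNumberIs b (d - 3))) ∧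
    (∀ (𝕜 R ι : Type*) [RCLike 𝕜] [LieRing R] [LieAlgebra 𝕜 R] [Module.Finite 𝕜 R]
        [LieAlgebra.IsSolvable R] [Fintype ι] [DecidableEq ι]
        (π : LieAlgebra.SpecialLinear.sl (Fin 2) 𝕜 →ₗ⁅𝕜⁆ LieDerivation 𝕜 R R)
        (b : Module.Basis ι 𝕜
          (LieAlgebra.SemiDirectSum R (LieAlgebra.SpecialLinear.sl (Fin 2) 𝕜) π)) (d : ℕ),
        CoadjointInvariants.IsIrreducibleRep π → Module.finrank 𝕜 R = d →
          (d = 1 → CoadjointInvariants.AnalyticNumberIs b 2 ∧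
            CoadjointInvariants.LocalNumberIs b 2) ∧
          (d = 2 → CoadjointInvariants.AnalyticNumberIs b 1 ∧
            CoadjointInvariants.LocalNumberIs b 1) ∧
          (d = 3 → CoadjointInvariants.AnalyticNumberIs b 2 ∧
            CoadjointInvariants.LocalNumberIs b 2) ∧
          (4 ≤ d → CoadjointInvariants.AnalyticNumberIs b (d - 3) ∧
            CoadjointInvariants.LocalNumberIs b (d - 3))) := by
  refine ⟨fun K R ι _ _ _ _ _ _ _ π b d hπ hd => ?_,
    fun 𝕜 R ι _ _ _ _ _ _ _ π b d hπ hd => ?_⟩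
  · obtain ⟨m, hm, ⟨S⟩⟩ := CoadjointInvariants.exists_standardFrame π hπ
    rw [hd] at hm
    refine ⟨fun h => ?_, fun h => ?_, fun h => ?_, fun h => ?_⟩
    · obtain rfl : m = 0 := by omega
      exact CoadjointInvariants.polyNumberIs_of_grad b (S.exists_corank_le_zero b)
        (S.exists_le_finrank_zero b)
    · obtain rfl : m = 1 := by omega
      exact CoadjointInvariants.polyNumberIs_of_grad b (S.exists_corank_le_one b)
        (S.exists_le_finrank_one b)
    · obtain rfl : m = 2 := by omega
      exact CoadjointInvariants.polyNumberIs_of_grad b (S.exists_corank_le_two b)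
        (S.exists_le_finrank_two b)
    · rw [show d - 3 = m - 2 by omega]
      exact CoadjointInvariants.polyNumberIs_of_grad b
        (S.exists_corank_le_of_three_le (by omega) b) (S.exists_le_finrank_of_three_le (by omega) b)
  · obtain ⟨m, hm, ⟨S⟩⟩ := CoadjointInvariants.exists_standardFrame π hπ
    rw [hd] at hm
    have key : ∀ N, (∃ p, Module.finrank 𝕜
        (LinearMap.ker (CoadjointInvariants.commMatrix b p).mulVecLin) ≤ N) →
        (∃ p, N ≤ Module.finrank 𝕜 (Submodule.span 𝕜 (CoadjointInvariants.gradAt p ''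
          CoadjointInvariants.polyInvariants b))) →
        CoadjointInvariants.AnalyticNumberIs b N ∧ CoadjointInvariants.LocalNumberIs b N :=
      fun N hU hL => ⟨CoadjointInvariants.analyticNumberIs_of_grad b hU hL,
        CoadjointInvariants.localNumberIs_of_grad b hU hL⟩
    refine ⟨fun h => ?_, fun h => ?_, fun h => ?_, fun h => ?_⟩
    · obtain rfl : m = 0 := by omega
      exact key _ (S.exists_corank_le_zero b) (S.exists_le_finrank_zero b)
    · obtain rfl : m = 1 := by omega
      exact key _ (S.exists_corank_le_one b) (S.exists_le_finrank_one b)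
    · obtain rfl : m = 2 := by omega
      exact key _ (S.exists_corank_le_two b) (S.exists_le_finrank_two b)
    · rw [show d - 3 = m - 2 by omega]
      exact key _ (S.exists_corank_le_of_three_le (by omega) b)
        (S.exists_le_finrank_of_three_le (by omega) b)
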